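/- Let $n\ge 3$, let $d_*v$ be the $O(n)$-invariant probability measure on the unit sphere $S^{n-1}\subset\mathbb R^n$, and let $f:S^{n-1}\to\mathbb C$ be even and smooth (i.e. $x\mapsto f(x/|x|)$ is $C^\infty$ on $\mathbb R^n\setminus\{0\}$), with $\int_{S^{n-1}} f(v)\,d_*v=0$. For $\operatorname{Re}\lambda>-1$, $\lambda\ne 0,2,4,\dots$, put $$(\mathscr C^\lambda f)(u)=\frac{\pi^{1/2}\,\Gamma(-\lambda/2)}{\Gamma(n/2)\,\Gamma((\lambda+1)/2)}\int_{S^{n-1}} f(v)\,|u\cdot v|^\lambda\,d_*v,\qquad u\in S^{n-1},$$ and for other $\lambda\in\mathbb C\setminus\{0,2,4,\dots\}$ let $\mathscr C^\lambda f$ be the meromorphic continuation in $\lambda$ (pointwise in $u$) of this absolutely convergent integral. Let $$(\mathscr C_{\log}f)(u)=\frac{2}{\Gamma(n/2)}\int_{S^{n-1}} f(v)\,\log\frac1{|u\cdot v|}\,d_*v .$$ For a function $g$ on $S^{n-1}$ write $(E_\lambda g)(x)=|x|^\lambda g(x/|x|)$, $x\neq0$, and, with $\Delta$ the Laplacian of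 $\mathbb R^n$ and $\ell$ a nonnegative integer, $$(\Delta_{\lambda}g)(u)=-\tfrac14\,(\Delta E_{\lambda+2}\,g)(u),\qquad (\Delta_{\lambda,\ell}\,g)(u)=\left(-\tfrac14\right)^{\ell}(\Delta^\ell E_{\lambda+2\ell}\,g)(u),\qquad u\in S^{n-1}.$$ Then the continuation $\mathscr C^\lambda f$ exists on $\mathbb C$, is holomorphic off $\{0,2,4,\dots\}$, the integral defining $\mathscr C_{\log}f$ converges absolutely for every $u\in S^{n-1}$, $\mathscr C_{\log}f$ is smooth on $S^{n-1}$, and $$\Delta_{-2}\,\mathscr C_{\log}f=\mathscr C^{-2}f,\qquad\text{and more generally}\qquad \Delta_{-2\ell,\ell}\,\mathscr C_{\log}f=\mathscr C^{-2\ell}f\quad\text{for all }\ell=1,2,3,\dots$$ -/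

import Mathlib

open MeasureTheory

namespace CosineTransform

/-- The unit sphere `S^{n-1}` in `ℝ^n`. -/
abbrev USphere (n : ℕ) : Type := Metric.sphere (0 : EuclideanSpace ℝ (Fin n)) 1

/-- The direction `x / |x|` of a nonzero vector, as a point of the unit sphere. -/
noncomputable def direction {n : ℕ} (x : EuclideanSpace ℝ (Fin n)) (hx : x ≠ 0) : USphere n :=
  ⟨‖x‖⁻¹ • x, by simp [norm_smul, hx]⟩

open Classical in
/-- The `lam`-homogeneous extension `(E_lam f)(x) = |x|^lam f(x/|x|)` to `x ≠ 0`
(the value at the origin is set to `0` and is never used). -/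
noncomputable def homExt {n : ℕ} (lam : ℂ) (f : USphere n → ℂ)
    (x : EuclideanSpace ℝ (Fin n)) : ℂ :=
  if hx : x = 0 then 0 else (‖x‖ : ℂ) ^ lam * f (direction x hx)

/-- `f ∈ C^∞(S^{n-1})`: the extension `x ↦ f(x/|x|)` is smooth on `ℝ^n ∖ {0}`. -/
def SphereSmooth {n : ℕ} (f : USphere n → ℂ) : Prop :=
  ContDiffOn ℝ ((⊤ : ℕ∞) : WithTop ℕ∞) (homExt 0 f) {0}ᶜ

/-- The rotation invariant probability measure on `S^{n-1}`: normalized surface measure. -/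
noncomputable def sphereProb (n : ℕ) : Measure (USphere n) :=
  ((volume : Measure (EuclideanSpace ℝ (Fin n))).toSphere Set.univ)⁻¹ •
    (volume : Measure (EuclideanSpace ℝ (Fin n))).toSphere

/-- The inner product `u · v` of two points of the unit sphere. -/
noncomputable def sdot {n : ℕ} (u v : USphere n) : ℝ :=
  inner ℝ (u : EuclideanSpace ℝ (Fin n)) (v : EuclideanSpace ℝ (Fin n))

/-- The normalizing factor
`γ(lam) = π^{1/2} Γ(-lam/2) / (Γ(n/2) Γ((lam+1)/2))`. -/
noncomputable def cosFactor (n : ℕ) (lam : ℂ) : ℂ :=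
  (Real.sqrt Real.pi : ℂ) * Complex.Gamma (-lam / 2) /
    (Complex.Gamma ((n : ℂ) / 2) * Complex.Gamma ((lam + 1) / 2))

/-- The integrand `v ↦ f(v) |u · v|^lam`. -/
noncomputable def cosIntegrand {n : ℕ} (f : USphere n → ℂ) (lam : ℂ) (u v : USphere n) : ℂ :=
  f v * ((|sdot u v| : ℝ) : ℂ) ^ lam

/-- The set `ℂ ∖ {0, 2, 4, …}`. -/
def regularSet : Set ℂ := {lam : ℂ | ∀ k : ℕ, lam ≠ 2 * (k : ℂ)}

/-- `G` is the meromorphic continuation in `lam` of the normalized cosine transform of `f`: for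
every `u`, the function `lam ↦ G lam u` is meromorphic on `ℂ`, holomorphic off `{0, 2, 4, …}`, and
for `Re lam > -1`, `lam ∉ {0, 2, 4, …}`, it is given by the absolutely convergent integral
`γ(lam) ∫ f(v) |u · v|^lam d_*v`. -/
structure IsCosContinuation {n : ℕ} (f : USphere n → ℂ) (G : ℂ → USphere n → ℂ) : Prop where
  meromorphic : ∀ (u : USphere n) (z : ℂ), MeromorphicAt (fun lam => G lam u) z
  holomorphic : ∀ u : USphere n, DifferentiableOn ℂ (fun lam => G lam u) regularSet
  integrable : ∀ (u : USphere n) (lam : ℂ), -1 < lam.re → lam ∈ regularSet →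
    Integrable (cosIntegrand f lam u) (sphereProb n)
  eq_integral : ∀ (u : USphere n) (lam : ℂ), -1 < lam.re → lam ∈ regularSet →
    G lam u = cosFactor n lam * ∫ v, cosIntegrand f lam u v ∂(sphereProb n)

theorem isOpen_regularSet : IsOpen regularSet := by
  have h : regularSet = (Set.range (fun k : ℕ => (2 * (k : ℂ))))ᶜ := by
    ext z
    simp [regularSet, eq_comm]
  rw [h, isOpen_compl_iff]
  have h2 : IsClosed (Set.range ((↑) : ℕ → ℂ)) := by
    have := Nat.isClosedEmbedding_coe_real
    have h3 : Topology.IsClosedEmbedding (fun k : ℕ => (((k : ℝ)) : ℂ)) :=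
      Complex.isometry_ofReal.isClosedEmbedding.comp this
    simpa using h3.isClosed_range
  have h4 := (Homeomorph.mulLeft₀ (2 : ℂ) two_ne_zero).isClosedMap _ h2
  rw [← Set.range_comp] at h4
  exact h4

theorem isPreconnected_regularSet : IsPreconnected regularSet := by
  have h : regularSet = (Set.range (fun k : ℕ => (2 * (k : ℂ))))ᶜ := by
    ext z
    simp [regularSet, eq_comm]
  rw [h]
  exact ((Set.countable_range _).isConnected_compl_of_one_lt_rank
    (by simp [Complex.rank_real_complex])).isPreconnected

/-- The continuation is unique on `ℂ ∖ {0, 2, 4, …}`. -/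
theorem IsCosContinuation.unique {n : ℕ} {f : USphere n → ℂ} {G H : ℂ → USphere n → ℂ}
    (hG : IsCosContinuation f G) (hH : IsCosContinuation f H) {lam : ℂ}
    (hlam : lam ∈ regularSet) (u : USphere n) : G lam u = H lam u := by
  have h1 : (1 : ℂ) ∈ regularSet := by
    intro k hk
    have : (1 : ℕ) = 2 * k := by exact_mod_cast hk
    omega
  have hre : ∀ᶠ z : ℂ in nhds 1, -1 < z.re :=
    (isOpen_lt continuous_const Complex.continuous_re).mem_nhds (by norm_num)
  have hev : (fun z => G z u) =ᶠ[nhds 1] (fun z => H z u) := by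
    filter_upwards [hre, isOpen_regularSet.mem_nhds h1] with z hz hz'
    rw [hG.eq_integral u z hz hz', hH.eq_integral u z hz hz']
  exact ((hG.holomorphic u).analyticOnNhd isOpen_regularSet).eqOn_of_preconnected_of_eventuallyEq
    ((hH.holomorphic u).analyticOnNhd isOpen_regularSet) isPreconnected_regularSet h1 hev hlam

open Classical in
/-- The normalized cosine transform `(C^lam f)(u)`, for `lam ∈ ℂ ∖ {0, 2, 4, …}`, understood as the
meromorphic continuation of `γ(lam) ∫ f(v) |u · v|^lam d_*v`. -/
noncomputable def cosTransform {n : ℕ} (lam : ℂ) (f : USphere n → ℂ) : USphere n → ℂ :=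
  if h : ∃ G, IsCosContinuation f G then h.choose lam else 0

/-- The integrand `v ↦ f(v) log (1 / |u · v|)`. -/
noncomputable def logIntegrand {n : ℕ} (f : USphere n → ℂ) (u v : USphere n) : ℂ :=
  f v * ((Real.log (1 / |sdot u v|) : ℝ) : ℂ)

/-- The logarithmic cosine transform
`(C_log f)(u) = 2 / Γ(n/2) * ∫ f(v) log (1 / |u · v|) d_*v`. -/
noncomputable def cosLog {n : ℕ} (f : USphere n → ℂ) (u : USphere n) : ℂ :=
  2 / Complex.Gamma ((n : ℂ) / 2) * ∫ v, logIntegrand f u v ∂(sphereProb n)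

/-- The weighted differential operator `(Δ_lam f)(u) = -1/4 (Δ E_{lam+2} f)(u)`, where `Δ` is the
Laplacian of `ℝ^n`. -/
noncomputable def wLap {n : ℕ} (lam : ℂ) (f : USphere n → ℂ) (u : USphere n) : ℂ :=
  -(1 / 4 : ℂ) * Laplacian.laplacian (homExt (lam + 2) f) (u : EuclideanSpace ℝ (Fin n))

/-- The weighted differential operator
`(Δ_{lam,l} f)(u) = (-1/4)^l (Δ^l E_{lam+2l} f)(u)`. -/
noncomputable def wLapPow {n : ℕ} (lam : ℂ) (l : ℕ) (f : USphere n → ℂ) (u : USphere n) : ℂ :=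
  (-(1 / 4 : ℂ)) ^ l *
    ((Laplacian.laplacian : (EuclideanSpace ℝ (Fin n) → ℂ) → EuclideanSpace ℝ (Fin n) → ℂ)^[l]
      (homExt (lam + 2 * (l : ℂ)) f)) (u : EuclideanSpace ℝ (Fin n))

end CosineTransform

/-!
Write `E_λ g` for the extension of `g` to `ℝ^n ∖ {0}` that is homogeneous of degree `λ`, and `D` for
the spherical Laplacian, realised as the Casimir operator `1/2 ∑_{i,j} (x_i ∂_j - x_j ∂_i)^2` of the
rotation group (`sphLap`). On homogeneous functions
`Δ E_λ g = E_{λ-2} (D g + λ (λ + n - 2) g)` (`laplacian_homExt`), so the powers of `Δ` act on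
functions homogeneous of degree `0` through explicit polynomials in `D`.

Since the measure is rotation invariant, an integral operator with kernel `k (u · v)` commutes with
rotations. Differentiating this along one-parameter groups shows that it commutes with `D`
(`sphLap_zonal`), and integrating by parts along these groups moves `D` from `g` to the kernel
(`zonal_sphLap_of_contDiff`). Pulling the integral back by reflections that depend smoothly on `u`
moves all derivatives in `u` to `g`, so the operator preserves smoothness even for a kernel that is
only integrable (`SphereSmooth.zonal`). The kernels `|u · v|^λ`, `Re λ > -1`, and `log |u · v|` are
integrable because a band of width `ε` around an equator has measure `O(ε)`.

For the kernel `|u · v|^λ` the integration by parts gives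
`(λ + 2) (λ + 1) Φ_λ g = Φ_{λ+2} (D g + (λ + 2) (λ + n) g)`, where `Φ_λ` is the unnormalized
transform. After division by `Γ((λ+1)/2)` it becomes a recursion which continues the transform to an
entire function `H_g` of `λ` (`exists_entire_continuation`); the only apparent pole, at `λ = -2`, is
cancelled because `D g` has mean zero. Hence `Γ(-λ/2) H_g(λ)` is the continuation sought.

The derivative of this recursion at `λ = -2` gives `C^{-2} f = -1/4 C_log (D f)`, as the derivative
of `|t|^λ` at `λ = 0` is `log |t|` and the mean of `f` vanishes. As `D` commutes with `C_log`, this is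
the first identity. The recursion at `λ = -2 l - 2` is the recursion for the polynomials in `D` that
represent `Δ^l`, which gives the others by induction.
-/

namespace CosineTransform

open scoped Pointwise

/-! ### The rotation invariant measure and the singularity of the kernels -/

/-- The space `ℝ^n` with its Euclidean norm. -/
abbrev Euc (n : ℕ) : Type := EuclideanSpace ℝ (Fin n)

/-- The action of a linear isometry of `ℝ^n` on the unit sphere. -/
noncomputable def sphereMap {n : ℕ} (R : Euc n ≃ₗᵢ[ℝ] Euc n) (v : USphere n) : USphere n :=
  ⟨R v, by simp⟩

@[simp]
theorem coe_sphereMap {n : ℕ} (R : Euc n ≃ₗᵢ[ℝ] Euc n) (v : USphere n) :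
    (sphereMap R v : Euc n) = R v := rfl

theorem continuous_sphereMap {n : ℕ} (R : Euc n ≃ₗᵢ[ℝ] Euc n) : Continuous (sphereMap R) :=
  (R.continuous.comp continuous_subtype_val).subtype_mk _

theorem continuous_sdot {n : ℕ} (u : USphere n) : Continuous (sdot u) :=
  continuous_const.inner continuous_subtype_val

theorem abs_sdot_le_one {n : ℕ} (u v : USphere n) : |sdot u v| ≤ 1 := by
  simpa [sdot] using abs_real_inner_le_norm (u : Euc n) (v : Euc n)

theorem sdot_sphereMap {n : ℕ} (R : Euc n ≃ₗᵢ[ℝ] Euc n) (u v : USphere n) :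
    sdot (sphereMap R u) (sphereMap R v) = sdot u v := R.inner_map_map _ _

theorem sphereProb_apply {n : ℕ} (s : Set (USphere n)) :
    sphereProb n s = ((volume : Measure (Euc n)).toSphere Set.univ)⁻¹ *
      (volume : Measure (Euc n)).toSphere s := by
  simp [sphereProb]

theorem toSphere_univ_ne_zero (n : ℕ) [NeZero n] :
    (volume : Measure (Euc n)).toSphere Set.univ ≠ 0 :=
  Measure.measure_univ_ne_zero.2 (Measure.toSphere_ne_zero _)

instance {n : ℕ} [NeZero n] : IsProbabilityMeasure (sphereProb n) := by
  refine ⟨?_⟩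
  rw [sphereProb_apply]
  exact ENNReal.inv_mul_cancel (toSphere_univ_ne_zero n) (measure_ne_top _ _)

theorem measurePreserving_sphereMap {n : ℕ} (R : Euc n ≃ₗᵢ[ℝ] Euc n) :
    MeasurePreserving (sphereMap R) (sphereProb n) (sphereProb n) := by
  have hm := (continuous_sphereMap R).measurable
  refine ⟨hm, ?_⟩
  ext s hs
  rw [Measure.map_apply hm hs, sphereProb_apply, sphereProb_apply,
    Measure.toSphere_apply' _ hs, Measure.toSphere_apply' _ (hm hs),
    ← (show MeasurePreserving R.symm.toMeasurableEquiv volume volume from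
      R.symm.measurePreserving).measure_preimage_equiv]
  congr 3
  ext x
  simp only [Set.mem_smul, Set.mem_image, Set.mem_preimage, LinearIsometryEquiv.coe_toMeasurableEquiv]
  constructor
  · rintro ⟨r, hr, _, ⟨v, hv, rfl⟩, h⟩
    exact ⟨r, hr, _, ⟨sphereMap R v, hv, rfl⟩, by simpa using congrArg R h⟩
  · rintro ⟨r, hr, _, ⟨v, hv, rfl⟩, rfl⟩
    have : sphereMap R (sphereMap R.symm v) = v := Subtype.ext (by simp)
    exact ⟨r, hr, _, ⟨sphereMap R.symm v, by rwa [this], rfl⟩, by simp⟩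

/-- The isometries act transitively on the sphere: a hyperplane reflection interchanges two given
unit vectors. -/
theorem exists_sphereMap_eq {n : ℕ} (u w : USphere n) :
    ∃ R : Euc n ≃ₗᵢ[ℝ] Euc n, sphereMap R u = w :=
  ⟨(ℝ ∙ ((u : Euc n) - w))ᗮ.reflection,
    Subtype.ext (Submodule.reflection_sub (by simp))⟩

theorem integral_sphereMap {n : ℕ} (R : Euc n ≃ₗᵢ[ℝ] Euc n) (g : USphere n → ℂ) :
    ∫ v, g (sphereMap R v) ∂(sphereProb n) = ∫ v, g v ∂(sphereProb n) := by
  refine (measurePreserving_sphereMap R).integral_comp ?_ g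
  have hinv : Function.LeftInverse (sphereMap R.symm) (sphereMap R) :=
    fun v => Subtype.ext (by simp)
  have hinv' : Function.RightInverse (sphereMap R.symm) (sphereMap R) :=
    fun v => Subtype.ext (by simp)
  exact (Homeomorph.measurableEmbedding
    ⟨⟨sphereMap R, sphereMap R.symm, hinv, hinv'⟩, continuous_sphereMap R,
      continuous_sphereMap R.symm⟩)

/-- A band of half-width `ε` around an equator has measure `O(ε)`. The band is rotated to be
orthogonal to a coordinate axis; the cone over it is then contained in a box. -/
theorem exists_measure_band_le (n : ℕ) [NeZero n] :
    ∃ C : ℝ, 0 ≤ C ∧ ∀ (u : USphere n) (ε : ℝ), 0 ≤ ε →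
      sphereProb n {v | |sdot u v| ≤ ε} ≤ ENNReal.ofReal (C * ε) := by
  set c : ENNReal := ((volume : Measure (Euc n)).toSphere Set.univ)⁻¹ with hc
  have hct : c ≠ ⊤ := ENNReal.inv_ne_top.2 (toSphere_univ_ne_zero n)
  refine ⟨c.toReal * (n * 4 ^ n), by positivity, fun u ε hε => ?_⟩
  let e : USphere n := ⟨EuclideanSpace.single 0 1, by simp⟩
  obtain ⟨R, hR⟩ := exists_sphereMap_eq e u
  have hmeas : ∀ w : USphere n, MeasurableSet {v | |sdot w v| ≤ ε} := fun w =>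
    (isClosed_le (continuous_sdot w).abs continuous_const).measurableSet
  have h1 : sphereProb n {v | |sdot u v| ≤ ε} = sphereProb n {v | |sdot e v| ≤ ε} := by
    rw [← (measurePreserving_sphereMap R).measure_preimage (hmeas u).nullMeasurableSet]
    congr 1
    ext v
    simp [← hR, sdot_sphereMap]
  have h2 : (volume : Measure (Euc n)) (Set.Ioo (0 : ℝ) 1 • (Subtype.val '' {v | |sdot e v| ≤ ε})) ≤
      ENNReal.ofReal (4 ^ n * ε) := by
    let r : Fin n → ℝ := fun i => if i = 0 then ε else 1
    have hsub : Set.Ioo (0 : ℝ) 1 • (Subtype.val '' {v : USphere n | |sdot e v| ≤ ε}) ⊆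
        (MeasurableEquiv.toLp 2 (Fin n → ℝ)).symm ⁻¹'
          (Set.univ.pi fun i => Set.Icc (-r i) (r i)) := by
      rintro _ ⟨s, hs, _, ⟨v, hv, rfl⟩, rfl⟩
      simp only [Set.mem_preimage, Set.mem_univ_pi, Set.mem_Icc, ← abs_le]
      intro i
      have hcoord : ∀ i, |(v : Euc n) i| ≤ 1 := fun i => by
        simpa using PiLp.norm_apply_le (v : Euc n) i
      have h0 : |(v : Euc n) 0| ≤ ε := by
        simpa [sdot, e, EuclideanSpace.inner_single_left] using hv
      have hle : |s * (v : Euc n) i| ≤ |(v : Euc n) i| := by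
        rw [abs_mul, abs_of_pos hs.1]
        exact mul_le_of_le_one_left (abs_nonneg _) hs.2.le
      refine (show _ = |s * (v : Euc n) i| by rfl).le.trans (hle.trans ?_)
      by_cases hi : i = 0
      · simp only [r, hi, if_true]; exact h0
      · simp only [r, hi, if_false]; exact hcoord i
    refine (measure_mono hsub).trans ?_
    rw [(EuclideanSpace.volume_preserving_symm_measurableEquiv_toLp (Fin n)).measure_preimage_equiv,
      Set.pi_univ_Icc, Real.volume_Icc_pi, ← ENNReal.ofReal_prod_of_nonneg]
    · apply ENNReal.ofReal_le_ofReal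
      rw [Finset.prod_eq_mul_prod_sdiff_singleton_of_mem (Finset.mem_univ (0 : Fin n))]
      have h3 : ∏ x ∈ Finset.univ \ {(0 : Fin n)}, (r x - -r x) ≤ 2 ^ n := by
        rw [Finset.prod_congr rfl (g := fun _ => (2 : ℝ))]
        · rw [Finset.prod_const]
          apply pow_le_pow_right₀ (by norm_num)
          exact (Finset.card_le_univ _).trans (by simp)
        · intro i hi
          have : i ≠ 0 := by simpa using hi
          simp only [r, this, if_false]; norm_num
      have h4 : (2 : ℝ) * 2 ^ n ≤ 4 ^ n := by
        have : (2 : ℝ) ≤ 2 ^ n := by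
          simpa using pow_le_pow_right₀ (by norm_num : (1 : ℝ) ≤ 2) (NeZero.one_le (n := n))
        calc (2 : ℝ) * 2 ^ n ≤ 2 ^ n * 2 ^ n := by gcongr
          _ = 4 ^ n := by rw [← mul_pow]; norm_num
      calc (r 0 - -r 0) * ∏ x ∈ Finset.univ \ {(0 : Fin n)}, (r x - -r x)
          ≤ (2 * ε) * 2 ^ n := by
            have : r 0 - -r 0 = 2 * ε := by simp only [r, if_true]; ring
            rw [this]; gcongr
        _ = (2 * 2 ^ n) * ε := by ring
        _ ≤ 4 ^ n * ε := by gcongr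
    · intro i _
      simp only [r]; split_ifs <;> linarith
  rw [h1, sphereProb_apply, ← hc, Measure.toSphere_apply' _ (hmeas e)]
  calc c * (Module.finrank ℝ (Euc n) *
        (volume : Measure (Euc n)) (Set.Ioo (0 : ℝ) 1 • (Subtype.val '' {v | |sdot e v| ≤ ε})))
      ≤ ENNReal.ofReal c.toReal * (ENNReal.ofReal n * ENNReal.ofReal (4 ^ n * ε)) := by
        rw [ENNReal.ofReal_toReal hct]
        gcongr
        simp
    _ = ENNReal.ofReal (c.toReal * (n * 4 ^ n) * ε) := by
        rw [← ENNReal.ofReal_mul (by positivity), ← ENNReal.ofReal_mul (by positivity)]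
        congr 1; ring

theorem ae_sdot_ne_zero {n : ℕ} [NeZero n] (u : USphere n) :
    ∀ᵐ v ∂(sphereProb n), sdot u v ≠ 0 := by
  obtain ⟨C, -, h⟩ := exists_measure_band_le n
  have := h u 0 le_rfl
  rw [ae_iff]
  simpa using this

/-- The kernel `|u · v|^s` is integrable for `s > -1`: for `s < 0` this is the layer cake formula
together with the estimate for the measure of a band. -/
theorem integrable_abs_sdot_rpow {n : ℕ} [NeZero n] (u : USphere n) {s : ℝ} (hs : -1 < s) :
    Integrable (fun v => |sdot u v| ^ s) (sphereProb n) := by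
  have hmeas : Measurable fun v : USphere n => |sdot u v| ^ s :=
    (continuous_sdot u).abs.measurable.pow_const s
  rcases le_or_gt 0 s with h0 | h0
  · refine Integrable.of_bound hmeas.aestronglyMeasurable 1 (Filter.Eventually.of_forall fun v => ?_)
    rw [Real.norm_of_nonneg (by positivity)]
    exact Real.rpow_le_one (abs_nonneg _) (abs_sdot_le_one u v) h0
  obtain ⟨C, hC, hband⟩ := exists_measure_band_le n
  refine ⟨hmeas.aestronglyMeasurable, ?_⟩
  rw [hasFiniteIntegral_iff_ofReal (Filter.Eventually.of_forall fun v => by positivity),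
    lintegral_eq_lintegral_meas_le _ (Filter.Eventually.of_forall fun v => by positivity)
      hmeas.aemeasurable]
  have hsplit : Set.Ioi (0 : ℝ) = Set.Ioc 0 1 ∪ Set.Ioi 1 :=
    (Set.Ioc_union_Ioi_eq_Ioi zero_le_one).symm
  rw [hsplit]
  refine (lintegral_union_le _ _ _).trans_lt (ENNReal.add_lt_top.2 ⟨?_, ?_⟩)
  · calc _ ≤ ∫⁻ _ in Set.Ioc (0 : ℝ) 1, 1 := lintegral_mono fun t => prob_le_one
      _ < ⊤ := by simp
  · have hle : ∀ t ∈ Set.Ioi (1 : ℝ), sphereProb n {v | t ≤ |sdot u v| ^ s} ≤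
        ENNReal.ofReal (C * t ^ (1 / s)) := by
      intro t ht
      have ht0 : (0 : ℝ) < t := zero_lt_one.trans ht
      refine (measure_mono fun v hv => ?_).trans (hband u (t ^ (1 / s)) (by positivity))
      have hv' : t ≤ |sdot u v| ^ s := hv
      rcases (abs_nonneg (sdot u v)).eq_or_lt' with h | h
      · simp only [Set.mem_ofPred_eq, h]; positivity
      · have := Real.rpow_le_rpow_of_nonpos ht0 hv' (one_div_neg.2 h0).le
        rwa [← Real.rpow_mul h.le, mul_one_div_cancel h0.ne, Real.rpow_one] at this
    refine (setLIntegral_mono' measurableSet_Ioi hle).trans_lt ?_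
    have hint : IntegrableOn (fun t : ℝ => C * t ^ (1 / s)) (Set.Ioi 1) := by
      refine (integrableOn_Ioi_rpow_of_lt ?_ zero_lt_one).const_mul C
      rw [div_lt_iff_of_neg h0]; linarith
    exact hint.lintegral_lt_top

/-- On the punctured interval `0 < t ≤ 1`, the logarithm is dominated by every negative power. -/
theorem abs_log_le_rpow {t δ : ℝ} (ht : 0 < t) (ht1 : t ≤ 1) (hδ : 0 < δ) :
    |Real.log t| ≤ t ^ (-δ) / δ := by
  have h := Real.log_le_rpow_div (inv_nonneg.2 ht.le) hδ
  rwa [Real.log_inv, Real.inv_rpow ht.le, ← Real.rpow_neg ht.le,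
    ← abs_of_nonpos (Real.log_nonpos ht.le ht1)] at h

theorem integrable_log_abs_sdot {n : ℕ} [NeZero n] (u : USphere n) :
    Integrable (fun v => Real.log |sdot u v|) (sphereProb n) := by
  refine ((integrable_abs_sdot_rpow u (s := -(1 / 2)) (by norm_num)).div_const (1 / 2)).mono'
    (continuous_sdot u).abs.measurable.log.aestronglyMeasurable ?_
  filter_upwards [ae_sdot_ne_zero u] with v hv
  exact abs_log_le_rpow (abs_pos.2 hv) (abs_sdot_le_one u v) (by norm_num)

theorem measurable_abs_sdot_cpow {n : ℕ} (u : USphere n) (lam : ℂ) :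
    Measurable fun v : USphere n => ((|sdot u v| : ℝ) : ℂ) ^ lam :=
  (Complex.measurable_ofReal.comp (continuous_sdot u).abs.measurable).pow_const lam

theorem integrable_abs_sdot_cpow {n : ℕ} [NeZero n] (u : USphere n) {lam : ℂ}
    (hlam : -1 < lam.re) :
    Integrable (fun v => ((|sdot u v| : ℝ) : ℂ) ^ lam) (sphereProb n) := by
  refine (integrable_abs_sdot_rpow u hlam).mono'
    (measurable_abs_sdot_cpow u lam).aestronglyMeasurable ?_
  filter_upwards [ae_sdot_ne_zero u] with v hv
  rw [Complex.norm_cpow_eq_rpow_re_of_pos (abs_pos.2 hv)]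

/-! ### Homogeneous extensions and smooth functions on the sphere -/

theorem homExt_zero_of_ne {n : ℕ} (g : USphere n → ℂ) {x : Euc n} (hx : x ≠ 0) :
    homExt 0 g x = g (direction x hx) := by
  simp [homExt, hx]

theorem homExt_of_ne {n : ℕ} (lam : ℂ) (g : USphere n → ℂ) {x : Euc n} (hx : x ≠ 0) :
    homExt lam g x = (‖x‖ : ℂ) ^ lam * homExt 0 g x := by
  rw [homExt_zero_of_ne g hx]; simp [homExt, hx]

theorem coe_ne_zero {n : ℕ} (u : USphere n) : (u : Euc n) ≠ 0 :=
  ne_zero_of_mem_unit_sphere u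

theorem direction_coe {n : ℕ} (u : USphere n) : direction (u : Euc n) (coe_ne_zero u) = u :=
  Subtype.ext (by simp [direction])

@[simp]
theorem homExt_coe {n : ℕ} (lam : ℂ) (g : USphere n → ℂ) (u : USphere n) :
    homExt lam g u = g u := by
  rw [homExt_of_ne _ _ (coe_ne_zero u), homExt_zero_of_ne g (coe_ne_zero u), direction_coe]
  simp

theorem homExt_zero_smul {n : ℕ} (g : USphere n → ℂ) {c : ℝ} (hc : 0 < c) (x : Euc n) :
    homExt 0 g (c • x) = homExt 0 g x := by
  by_cases hx : x = 0
  · simp [hx]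
  have hcx : c • x ≠ 0 := smul_ne_zero hc.ne' hx
  rw [homExt_zero_of_ne g hx, homExt_zero_of_ne g hcx]
  congr 1
  ext1
  simp only [direction, norm_smul, smul_smul, Real.norm_of_nonneg hc.le]
  congr 1
  field_simp

theorem isOpen_compl_zero {n : ℕ} : IsOpen ({0}ᶜ : Set (Euc n)) := isOpen_compl_singleton

theorem SphereSmooth.contDiffAt {n : ℕ} {g : USphere n → ℂ} (hg : SphereSmooth g) {x : Euc n}
    (hx : x ≠ 0) : ContDiffAt ℝ ((⊤ : ℕ∞) : WithTop ℕ∞) (homExt 0 g) x :=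
  ContDiffOn.contDiffAt hg (isOpen_compl_zero.mem_nhds hx)

theorem SphereSmooth.differentiableAt {n : ℕ} {g : USphere n → ℂ} (hg : SphereSmooth g)
    {x : Euc n} (hx : x ≠ 0) : DifferentiableAt ℝ (homExt 0 g) x :=
  (hg.contDiffAt hx).differentiableAt (by simp)

theorem SphereSmooth.continuous {n : ℕ} {g : USphere n → ℂ} (hg : SphereSmooth g) :
    Continuous g := by
  have h : Continuous fun u : USphere n => homExt 0 g u :=
    (ContDiffOn.continuousOn hg).comp_continuous continuous_subtype_val coe_ne_zero
  simpa using h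

theorem exists_norm_le_of_continuous {n : ℕ} {g : USphere n → ℂ} (hg : Continuous g) :
    ∃ M : ℝ, ∀ v, ‖g v‖ ≤ M := by
  obtain ⟨M, hM⟩ := isCompact_univ.exists_bound_of_continuousOn hg.continuousOn
  exact ⟨M, fun v => hM v trivial⟩

/-- Smoothness of a function on the sphere only depends on smoothness of a function on
`ℝ^n ∖ {0}` that agrees with its extension of degree `0`. -/
theorem sphereSmooth_of_eqOn {n : ℕ} {g : USphere n → ℂ} {F : Euc n → ℂ}
    (hF : ContDiffOn ℝ ((⊤ : ℕ∞) : WithTop ℕ∞) F {0}ᶜ) (h : ∀ x ≠ 0, homExt 0 g x = F x) :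
    SphereSmooth g :=
  hF.congr fun x hx => h x hx

theorem homExt_zero_add {n : ℕ} (f g : USphere n → ℂ) (x : Euc n) :
    homExt 0 (f + g) x = homExt 0 f x + homExt 0 g x := by
  by_cases hx : x = 0
  · simp [homExt, hx]
  · simp [homExt_zero_of_ne _ hx]

theorem homExt_zero_const_mul {n : ℕ} (c : ℂ) (g : USphere n → ℂ) (x : Euc n) :
    homExt 0 (fun v => c * g v) x = c * homExt 0 g x := by
  by_cases hx : x = 0
  · simp [homExt, hx]
  · simp [homExt_zero_of_ne _ hx]

theorem homExt_zero_sum {n : ℕ} {ι : Type*} (s : Finset ι) (g : ι → USphere n → ℂ) (x : Euc n) :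
    homExt 0 (fun v => ∑ i ∈ s, g i v) x = ∑ i ∈ s, homExt 0 (g i) x := by
  by_cases hx : x = 0
  · simp [homExt, hx]
  · simp [homExt_zero_of_ne _ hx]

theorem SphereSmooth.add {n : ℕ} {f g : USphere n → ℂ} (hf : SphereSmooth f)
    (hg : SphereSmooth g) : SphereSmooth (f + g) :=
  sphereSmooth_of_eqOn (ContDiffOn.add hf hg) fun x _ => homExt_zero_add f g x

theorem SphereSmooth.const_mul {n : ℕ} {g : USphere n → ℂ} (hg : SphereSmooth g) (c : ℂ) :
    SphereSmooth (fun v => c * g v) :=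
  sphereSmooth_of_eqOn (contDiffOn_const.mul hg) fun x _ => homExt_zero_const_mul c g x

theorem SphereSmooth.sum {n : ℕ} {ι : Type*} {s : Finset ι} {g : ι → USphere n → ℂ}
    (hg : ∀ i ∈ s, SphereSmooth (g i)) : SphereSmooth (fun v => ∑ i ∈ s, g i v) :=
  sphereSmooth_of_eqOn (ContDiffOn.sum hg) fun x _ => homExt_zero_sum s g x

theorem contDiffOn_norm_cpow {n : ℕ} (lam : ℂ) :
    ContDiffOn ℝ ((⊤ : ℕ∞) : WithTop ℕ∞) (fun x : Euc n => (‖x‖ : ℂ) ^ lam) {0}ᶜ := by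
  have h : ContDiffOn ℝ ((⊤ : ℕ∞) : WithTop ℕ∞)
      (fun x : Euc n => Complex.exp ((Real.log ‖x‖ : ℂ) * lam)) {0}ᶜ := by
    refine ContDiffOn.cexp (ContDiffOn.mul ?_ contDiffOn_const)
    exact Complex.ofRealCLM.contDiff.comp_contDiffOn
      ((contDiffOn_id.norm ℝ fun x hx => hx).log fun x hx => norm_ne_zero_iff.2 hx)
  refine h.congr fun x hx => ?_
  rw [Complex.cpow_def_of_ne_zero (by simpa using hx), Complex.ofReal_log (norm_nonneg x)]

theorem SphereSmooth.contDiffOn_homExt {n : ℕ} {g : USphere n → ℂ} (hg : SphereSmooth g)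
    (lam : ℂ) : ContDiffOn ℝ ((⊤ : ℕ∞) : WithTop ℕ∞) (homExt lam g) {0}ᶜ :=
  ((contDiffOn_norm_cpow lam).mul hg).congr fun _ hx => homExt_of_ne lam g hx

/-! ### One-parameter groups of rotations -/

/-- A linear map `A` of `ℝ^n` is skew-symmetric. -/
def IsSkew {n : ℕ} (A : Euc n →L[ℝ] Euc n) : Prop := ∀ x, inner ℝ (A x) x = (0 : ℝ)

theorem hasDerivAt_exp_smul_apply {n : ℕ} (A : Euc n →L[ℝ] Euc n) (x : Euc n) (t : ℝ) :
    HasDerivAt (fun s : ℝ => NormedSpace.exp (s • A) x) (A (NormedSpace.exp (t • A) x)) t := by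
  have h := (hasDerivAt_exp_smul_const' (𝕂 := ℝ) A t)
  simpa using h.clm_apply (hasDerivAt_const t x)

theorem exp_zero_smul_apply {n : ℕ} (A : Euc n →L[ℝ] Euc n) (x : Euc n) :
    NormedSpace.exp ((0 : ℝ) • A) x = x := by
  have h : (0 : ℝ) • A = 0 := @zero_smul ℝ (Euc n →L[ℝ] Euc n) _ _ _ A
  rw [h, NormedSpace.exp_zero]; rfl

theorem IsSkew.norm_exp {n : ℕ} {A : Euc n →L[ℝ] Euc n} (hA : IsSkew A) (t : ℝ) (x : Euc n) :
    ‖NormedSpace.exp (t • A) x‖ = ‖x‖ := by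
  have hder : ∀ s : ℝ, HasDerivAt (fun s : ℝ => ‖NormedSpace.exp (s • A) x‖ ^ 2) 0 s := by
    intro s
    have h := (hasDerivAt_exp_smul_apply A x s).norm_sq
    rwa [real_inner_comm, hA, mul_zero] at h
  have h := is_const_of_deriv_eq_zero (fun s => (hder s).differentiableAt)
    (fun s => (hder s).deriv) t 0
  simp only [exp_zero_smul_apply] at h
  exact (sq_eq_sq₀ (norm_nonneg _) (norm_nonneg _)).1 h

/-- The rotation `exp (t A)` generated by a skew-symmetric `A`. -/
noncomputable def IsSkew.rot {n : ℕ} {A : Euc n →L[ℝ] Euc n} (hA : IsSkew A) (t : ℝ) :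
    Euc n ≃ₗᵢ[ℝ] Euc n :=
  LinearIsometry.toLinearIsometryEquiv
    ⟨(NormedSpace.exp (t • A) : Euc n →L[ℝ] Euc n).toLinearMap, hA.norm_exp t⟩ rfl

@[simp]
theorem IsSkew.sphereMap_rot_zero {n : ℕ} {A : Euc n →L[ℝ] Euc n} (hA : IsSkew A)
    (u : USphere n) : sphereMap (hA.rot 0) u = u :=
  Subtype.ext (exp_zero_smul_apply A u)

theorem IsSkew.hasDerivAt_comp_rot {n : ℕ} {A : Euc n →L[ℝ] Euc n} (hA : IsSkew A)
    {F : Euc n → ℂ} {x : Euc n} {t : ℝ} (hF : DifferentiableAt ℝ F (hA.rot t x)) :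
    HasDerivAt (fun s => F (hA.rot s x)) (fderiv ℝ F (hA.rot t x) (A (hA.rot t x))) t :=
  hF.hasFDerivAt.comp_hasDerivAt t (hasDerivAt_exp_smul_apply A x t)

/-- The derivative of a function on the sphere along the rotations generated by `A`. -/
noncomputable def rotDeriv {n : ℕ} (A : Euc n →L[ℝ] Euc n) (g : USphere n → ℂ)
    (u : USphere n) : ℂ :=
  fderiv ℝ (homExt 0 g) u (A u)

theorem IsSkew.hasDerivAt_comp_sphereMap {n : ℕ} {A : Euc n →L[ℝ] Euc n} (hA : IsSkew A)
    {g : USphere n → ℂ} (hg : SphereSmooth g) (u : USphere n) (t : ℝ) :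
    HasDerivAt (fun s => g (sphereMap (hA.rot s) u)) (rotDeriv A g (sphereMap (hA.rot t) u)) t := by
  have h := hA.hasDerivAt_comp_rot (F := homExt 0 g) (x := u) (t := t)
    (hg.differentiableAt (coe_ne_zero (sphereMap (hA.rot t) u)))
  simp_rw [← coe_sphereMap, homExt_coe] at h
  exact h

/-- The extension of `rotDeriv A g` is the derivative of the extension of `g`. -/
theorem homExt_rotDeriv {n : ℕ} (A : Euc n →L[ℝ] Euc n) (g : USphere n → ℂ) {x : Euc n}
    (hx : x ≠ 0) : homExt 0 (rotDeriv A g) x = fderiv ℝ (homExt 0 g) x (A x) := by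
  have hc : 0 < ‖x‖⁻¹ := by positivity
  have h : (fun y => homExt 0 g (‖x‖⁻¹ • y)) = homExt 0 g :=
    funext fun y => homExt_zero_smul g hc y
  have h2 := fderiv_comp_smul (𝕜 := ℝ) (f := homExt 0 g) (x := x) ‖x‖⁻¹
  rw [h] at h2
  rw [homExt_zero_of_ne _ hx, h2]
  simp [rotDeriv, direction]

theorem contDiffOn_fderiv_apply {n : ℕ} {F : Euc n → ℂ}
    (hF : ContDiffOn ℝ ((⊤ : ℕ∞) : WithTop ℕ∞) F {0}ᶜ) (A : Euc n →L[ℝ] Euc n) :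
    ContDiffOn ℝ ((⊤ : ℕ∞) : WithTop ℕ∞) (fun x => fderiv ℝ F x (A x)) {0}ᶜ :=
  (hF.fderiv_of_isOpen isOpen_compl_zero (by simp)).clm_apply A.contDiff.contDiffOn

theorem SphereSmooth.rotDeriv {n : ℕ} {g : USphere n → ℂ} (hg : SphereSmooth g)
    (A : Euc n →L[ℝ] Euc n) : SphereSmooth (rotDeriv A g) :=
  sphereSmooth_of_eqOn (contDiffOn_fderiv_apply hg A) fun _ hx => homExt_rotDeriv A g hx

/-- Rotations preserve the norm, so differentiating along them commutes with multiplication by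
powers of the norm. -/
theorem fderiv_homExt_skew {n : ℕ} {A : Euc n →L[ℝ] Euc n} (hA : IsSkew A) {g : USphere n → ℂ}
    (hg : SphereSmooth g) (lam : ℂ) {x : Euc n} (hx : x ≠ 0) :
    fderiv ℝ (homExt lam g) x (A x) = homExt lam (CosineTransform.rotDeriv A g) x := by
  have h0 : hA.rot 0 x = x := exp_zero_smul_apply A x
  have hd : DifferentiableAt ℝ (homExt lam g) x :=
    ((hg.contDiffOn_homExt lam).contDiffAt (isOpen_compl_zero.mem_nhds hx)).differentiableAt
      (by simp)
  have h1 := hA.hasDerivAt_comp_rot (F := homExt lam g) (x := x) (t := 0) (by rwa [h0])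
  have h2 := (hA.hasDerivAt_comp_rot (F := homExt 0 g) (x := x) (t := 0)
    (by rw [h0]; exact hg.differentiableAt hx)).const_mul ((‖x‖ : ℂ) ^ lam)
  rw [h0] at h1 h2
  have h3 : (fun s => homExt lam g (hA.rot s x)) =
      fun s => (‖x‖ : ℂ) ^ lam * homExt 0 g (hA.rot s x) := by
    funext s
    rw [homExt_of_ne lam g (by simpa using hx), LinearIsometryEquiv.norm_map]
  rw [h3] at h1
  rw [h1.unique h2, homExt_of_ne _ _ hx, homExt_rotDeriv A g hx]

/-! ### The Laplacian in terms of rotations -/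

/-- The infinitesimal rotation `x ↦ x_i e_j - x_j e_i`. -/
noncomputable def rotGen {n : ℕ} (i j : Fin n) : Euc n →L[ℝ] Euc n :=
  (EuclideanSpace.proj i : Euc n →L[ℝ] ℝ).smulRight (EuclideanSpace.single j (1 : ℝ)) -
    (EuclideanSpace.proj j : Euc n →L[ℝ] ℝ).smulRight (EuclideanSpace.single i (1 : ℝ))

theorem rotGen_apply {n : ℕ} (i j : Fin n) (x : Euc n) :
    rotGen i j x = x i • EuclideanSpace.single j (1 : ℝ) -
      x j • EuclideanSpace.single i (1 : ℝ) := rfl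

theorem isSkew_rotGen {n : ℕ} (i j : Fin n) : IsSkew (rotGen i j) := by
  intro x
  simp [rotGen_apply, inner_sub_left, inner_smul_left, EuclideanSpace.inner_single_left, mul_comm]

/-- The Laplace--Beltrami operator of the sphere, as the Casimir operator
`1/2 ∑_{i,j} (x_i ∂_j - x_j ∂_i)^2` of the rotation group. -/
noncomputable def sphLap {n : ℕ} (g : USphere n → ℂ) (u : USphere n) : ℂ :=
  (1 / 2 : ℂ) * ∑ i : Fin n, ∑ j : Fin n, rotDeriv (rotGen i j) (rotDeriv (rotGen i j) g) u

theorem SphereSmooth.sphLap {n : ℕ} {g : USphere n → ℂ} (hg : SphereSmooth g) :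
    SphereSmooth (sphLap g) :=
  (SphereSmooth.sum fun _ _ => SphereSmooth.sum fun _ _ =>
    (hg.rotDeriv _).rotDeriv _).const_mul _

theorem euc_eq_sum {n : ℕ} (x : Euc n) : x = ∑ i, x i • EuclideanSpace.single i (1 : ℝ) := by
  simpa using ((EuclideanSpace.basisFun (Fin n) ℝ).sum_repr x).symm

/-- The second order part of the Casimir operator. -/
theorem sum_bilin_rotGen {n : ℕ} (B : Euc n →L[ℝ] Euc n →L[ℝ] ℂ) (x : Euc n) :
    ∑ i : Fin n, ∑ j : Fin n, B (rotGen i j x) (rotGen i j x) =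
      2 * ((‖x‖ ^ 2 : ℝ) * ∑ i : Fin n, B (EuclideanSpace.single i 1) (EuclideanSpace.single i 1)
        - B x x) := by
  have hB : B x x = ∑ i : Fin n, ∑ j : Fin n,
      ((x i : ℂ) * x j) * B (EuclideanSpace.single i 1) (EuclideanSpace.single j 1) := by
    rw [Finset.sum_comm]
    conv_lhs => rw [euc_eq_sum x]
    simp only [map_sum, map_smul, _root_.sum_apply, _root_.smul_apply,
      Complex.real_smul, Finset.smul_sum]
    exact Finset.sum_congr rfl fun i _ => Finset.sum_congr rfl fun j _ => by ring
  have hN : ((‖x‖ ^ 2 : ℝ) : ℂ) = ∑ i : Fin n, (x i : ℂ) ^ 2 := by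
    rw [EuclideanSpace.real_norm_sq_eq]; push_cast; rfl
  have hB' : B x x = ∑ i : Fin n, ∑ j : Fin n,
      ((x i : ℂ) * x j) * B (EuclideanSpace.single j 1) (EuclideanSpace.single i 1) := by
    rw [hB, Finset.sum_comm]
    exact Finset.sum_congr rfl fun i _ => Finset.sum_congr rfl fun j _ => by ring
  have h1 : ((‖x‖ ^ 2 : ℝ) : ℂ) * ∑ i : Fin n,
      B (EuclideanSpace.single i 1) (EuclideanSpace.single i 1) = ∑ i : Fin n, ∑ j : Fin n,
        (x i : ℂ) ^ 2 * B (EuclideanSpace.single j 1) (EuclideanSpace.single j 1) := by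
    rw [hN, Finset.sum_mul_sum]
  have h2 : ((‖x‖ ^ 2 : ℝ) : ℂ) * ∑ i : Fin n,
      B (EuclideanSpace.single i 1) (EuclideanSpace.single i 1) = ∑ i : Fin n, ∑ j : Fin n,
        (x j : ℂ) ^ 2 * B (EuclideanSpace.single i 1) (EuclideanSpace.single i 1) := by
    rw [h1, Finset.sum_comm]
  calc _ = ∑ i : Fin n, ∑ j : Fin n,
        ((x i : ℂ) ^ 2 * B (EuclideanSpace.single j 1) (EuclideanSpace.single j 1)
        + (x j : ℂ) ^ 2 * B (EuclideanSpace.single i 1) (EuclideanSpace.single i 1)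
        - ((x i : ℂ) * x j) * B (EuclideanSpace.single i 1) (EuclideanSpace.single j 1)
        - ((x i : ℂ) * x j) * B (EuclideanSpace.single j 1) (EuclideanSpace.single i 1)) := by
        refine Finset.sum_congr rfl fun i _ => Finset.sum_congr rfl fun j _ => ?_
        simp only [rotGen_apply, map_sub, map_smul, _root_.sub_apply,
          _root_.smul_apply, Complex.real_smul]
        ring
    _ = _ := by
        simp only [Finset.sum_add_distrib, Finset.sum_sub_distrib]
        rw [← h1, ← h2, ← hB, ← hB']
        ring

/-- The first order part of the Casimir operator. -/
theorem sum_rotGen_rotGen {n : ℕ} (x : Euc n) :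
    ∑ i : Fin n, ∑ j : Fin n, rotGen i j (rotGen i j x) = (-(2 * ((n : ℝ) - 1))) • x := by
  ext k
  simp only [rotGen_apply, PiLp.sub_apply, PiLp.smul_apply, PiLp.single_apply,
    smul_eq_mul, WithLp.ofLp_sum, Finset.sum_apply]
  simp only [mul_ite, mul_one, mul_zero, Finset.sum_sub_distrib,
    Finset.sum_ite_eq, Finset.mem_univ, if_true]
  simp
  ring

/-- The Laplacian in polar coordinates: the Casimir operator accounts for `|x|^2 Δ` up to the radial
terms, which Euler's relation evaluates on homogeneous functions. -/
theorem laplacian_homExt {n : ℕ} {g : USphere n → ℂ} (hg : SphereSmooth g) (lam : ℂ)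
    {x : Euc n} (hx : x ≠ 0) :
    Laplacian.laplacian (homExt lam g) x =
      homExt (lam - 2) (sphLap g + fun v => lam * (lam + n - 2) * g v) x := by
  set F := homExt lam g with hFdef
  have hF := hg.contDiffOn_homExt lam
  have hF2 : ContDiffOn ℝ ((⊤ : ℕ∞) : WithTop ℕ∞) (fderiv ℝ F) {0}ᶜ :=
    hF.fderiv_of_isOpen isOpen_compl_zero (by simp)
  have hd2 : DifferentiableAt ℝ (fderiv ℝ F) x :=
    (hF2.contDiffAt (isOpen_compl_zero.mem_nhds hx)).differentiableAt (by simp)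
  set B := fderiv ℝ (fderiv ℝ F) x with hB
  have hsecond : ∀ A : Euc n →L[ℝ] Euc n,
      fderiv ℝ (fun y => fderiv ℝ F y (A y)) x (A x) = B (A x) (A x) + fderiv ℝ F x (A (A x)) := by
    intro A
    have h := (hd2.hasFDerivAt.clm_apply A.hasFDerivAt).fderiv
    rw [h]
    simp [add_comm, hB]
  have hrot : ∀ i j : Fin n, homExt lam (rotDeriv (rotGen i j) (rotDeriv (rotGen i j) g)) x =
      B (rotGen i j x) (rotGen i j x) + fderiv ℝ F x (rotGen i j (rotGen i j x)) := by
    intro i j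
    have hsk := isSkew_rotGen i j
    rw [← hsecond, ← fderiv_homExt_skew hsk (hg.rotDeriv _) lam hx]
    congr 1
    refine Filter.EventuallyEq.fderiv_eq ?_
    filter_upwards [isOpen_compl_zero.mem_nhds hx] with y hy
    exact (fderiv_homExt_skew hsk hg lam hy).symm
  have hEuler : ∀ y : Euc n, y ≠ 0 → fderiv ℝ F y y = lam * F y := by
    intro y hy
    have hd : DifferentiableAt ℝ F y :=
      (hF.contDiffAt (isOpen_compl_zero.mem_nhds hy)).differentiableAt (by simp)
    have h1 : HasDerivAt (fun s : ℝ => F (s • y)) (fderiv ℝ F y y) 1 := by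
      have hl : HasDerivAt (fun s : ℝ => s • y) y 1 := by
        simpa using (hasDerivAt_id (1 : ℝ)).smul_const y
      have hd' : HasFDerivAt F (fderiv ℝ F y) ((1 : ℝ) • y) := by
        rw [one_smul]; exact hd.hasFDerivAt
      exact hd'.comp_hasDerivAt (1 : ℝ) hl
    have h2 : HasDerivAt (fun s : ℝ => (s : ℂ) ^ lam * F y) (lam * F y) 1 := by
      have h := ((hasDerivAt_id (1 : ℂ)).cpow_const (c := lam) (by simp)).comp_ofReal
      simpa using (h.mul_const (F y))
    refine h1.unique (h2.congr_of_eventuallyEq ?_)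
    filter_upwards [lt_mem_nhds (zero_lt_one' ℝ)] with s hs
    rw [hFdef, homExt_of_ne lam g (smul_ne_zero hs.ne' hy), homExt_of_ne lam g hy,
      homExt_zero_smul g hs, norm_smul, Real.norm_of_nonneg hs.le, Complex.ofReal_mul,
      Complex.mul_cpow_ofReal_nonneg hs.le (norm_nonneg y), mul_assoc]
  have hEuler2 : B x x = lam * (lam - 1) * F x := by
    have h := hsecond (ContinuousLinearMap.id ℝ (Euc n))
    have h' : fderiv ℝ (fun y => fderiv ℝ F y (ContinuousLinearMap.id ℝ (Euc n) y)) x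
        = fderiv ℝ (fun y => lam * F y) x := by
      refine Filter.EventuallyEq.fderiv_eq ?_
      filter_upwards [isOpen_compl_zero.mem_nhds hx] with y hy
      exact hEuler y hy
    have hd : DifferentiableAt ℝ F x :=
      (hF.contDiffAt (isOpen_compl_zero.mem_nhds hx)).differentiableAt (by simp)
    rw [h', fderiv_const_mul hd] at h
    simp only [_root_.smul_apply, ContinuousLinearMap.id_apply, smul_eq_mul,
      hEuler x hx] at h
    linear_combination -h
  have hsum : 2 * homExt lam (sphLap g) x =
      2 * ((‖x‖ ^ 2 : ℝ) * Laplacian.laplacian F x - B x x) -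
        2 * ((n : ℂ) - 1) * fderiv ℝ F x x := by
    have h1 : 2 * homExt lam (sphLap g) x = ∑ i : Fin n, ∑ j : Fin n,
        homExt lam (rotDeriv (rotGen i j) (rotDeriv (rotGen i j) g)) x := by
      simp only [homExt_of_ne lam _ hx, homExt_zero_of_ne _ hx, sphLap, ← Finset.mul_sum]
      ring
    rw [h1]
    simp only [hrot, Finset.sum_add_distrib]
    rw [sum_bilin_rotGen, InnerProductSpace.laplacian_eq_iteratedFDeriv_orthonormalBasis F
      (EuclideanSpace.basisFun (Fin n) ℝ)]
    simp only [← map_sum, sum_rotGen_rotGen, map_smul, iteratedFDeriv_two_apply,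
      EuclideanSpace.basisFun_apply, Complex.real_smul, Matrix.cons_val_zero, Matrix.cons_val_one]
    push_cast
    ring
  rw [hEuler x hx, hEuler2] at hsum
  have hnx : (‖x‖ : ℂ) ≠ 0 := by simpa using hx
  have hkey : (‖x‖ : ℂ) ^ 2 * Laplacian.laplacian F x =
      homExt lam (sphLap g) x + lam * (lam + n - 2) * F x := by
    push_cast at hsum
    linear_combination (-1 / 2) * hsum
  have hpow : (‖x‖ : ℂ) ^ lam = (‖x‖ : ℂ) ^ 2 * (‖x‖ : ℂ) ^ (lam - 2) := by
    rw [Complex.cpow_sub _ _ hnx]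
    have : (‖x‖ : ℂ) ^ (2 : ℂ) = (‖x‖ : ℂ) ^ 2 := by
      simp
    rw [this]; field_simp
  apply mul_left_cancel₀ (pow_ne_zero 2 hnx)
  rw [hkey, hFdef, homExt_of_ne lam _ hx, homExt_of_ne lam _ hx, homExt_of_ne (lam - 2) _ hx,
    homExt_zero_add, homExt_zero_const_mul, hpow]
  ring

/-! ### Zonal integral operators -/

/-- The integral operator on the sphere with the rotation invariant kernel `k (u · v)`. -/
noncomputable def zonal {n : ℕ} (k : ℝ → ℂ) (g : USphere n → ℂ) (u : USphere n) : ℂ :=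
  ∫ v, g v * k (sdot u v) ∂(sphereProb n)

theorem integrable_mul_kernel {n : ℕ} {g w : USphere n → ℂ} (hg : Continuous g)
    (hw : Integrable w (sphereProb n)) : Integrable (fun v => g v * w v) (sphereProb n) := by
  obtain ⟨M, hM⟩ := exists_norm_le_of_continuous hg
  exact hw.bdd_mul hg.aestronglyMeasurable (Filter.Eventually.of_forall hM)

theorem zonal_sphereMap {n : ℕ} (k : ℝ → ℂ) (g : USphere n → ℂ) (R : Euc n ≃ₗᵢ[ℝ] Euc n)
    (u : USphere n) :
    zonal k g (sphereMap R u) = ∫ v, g (sphereMap R v) * k (sdot u v) ∂(sphereProb n) := by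
  rw [zonal, ← integral_sphereMap R]
  simp only [sdot_sphereMap]

/-- Differentiation under the integral sign along a one-parameter group of rotations. -/
theorem hasDerivAt_integral_comp_rot {n : ℕ} {A : Euc n →L[ℝ] Euc n} (hA : IsSkew A)
    {H H' w : USphere n → ℂ} (hH : Continuous H) (hH' : Continuous H')
    (hder : ∀ v t, HasDerivAt (fun s => H (sphereMap (hA.rot s) v))
      (H' (sphereMap (hA.rot t) v)) t) (hw : Integrable w (sphereProb n)) :
    HasDerivAt (fun t => ∫ v, H (sphereMap (hA.rot t) v) * w v ∂(sphereProb n))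
      (∫ v, H' v * w v ∂(sphereProb n)) 0 := by
  obtain ⟨M, hM⟩ := exists_norm_le_of_continuous hH'
  have hint : ∀ t, Integrable (fun v => H (sphereMap (hA.rot t) v) * w v) (sphereProb n) :=
    fun t => integrable_mul_kernel (hH.comp (continuous_sphereMap _)) hw
  have h := (hasDerivAt_integral_of_dominated_loc_of_deriv_le (μ := sphereProb n)
    (F := fun t v => H (sphereMap (hA.rot t) v) * w v)
    (F' := fun t v => H' (sphereMap (hA.rot t) v) * w v)
    (bound := fun v => M * ‖w v‖) (x₀ := (0 : ℝ)) (s := Set.univ) Filter.univ_mem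
    (Filter.Eventually.of_forall fun t => (hint t).aestronglyMeasurable) (hint 0)
    (integrable_mul_kernel (hH'.comp (continuous_sphereMap _)) hw).aestronglyMeasurable
    (Filter.Eventually.of_forall fun v t _ => by
      rw [norm_mul]; exact mul_le_mul_of_nonneg_right (hM _) (norm_nonneg _))
    (hw.norm.const_mul M)
    (Filter.Eventually.of_forall fun v t _ => (hder v t).mul_const (w v))).2
  simpa using h

/-- Zonal operators commute with infinitesimal rotations. -/
theorem rotDeriv_zonal {n : ℕ} {A : Euc n →L[ℝ] Euc n} (hA : IsSkew A) {k : ℝ → ℂ}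
    {g : USphere n → ℂ} (hg : SphereSmooth g) (hZ : SphereSmooth (zonal k g)) (u : USphere n)
    (hk : Integrable (fun v => k (sdot u v)) (sphereProb n)) :
    rotDeriv A (zonal k g) u = zonal k (rotDeriv A g) u := by
  have h1 := hA.hasDerivAt_comp_sphereMap hZ u 0
  have h2 := hasDerivAt_integral_comp_rot hA hg.continuous (hg.rotDeriv A).continuous
    (hA.hasDerivAt_comp_sphereMap hg) hk
  simp only [zonal_sphereMap, hA.sphereMap_rot_zero] at h1
  exact h1.unique h2

/-- Integration by parts for infinitesimal rotations. -/
theorem integral_rotDeriv_mul {n : ℕ} [NeZero n] {A : Euc n →L[ℝ] Euc n} (hA : IsSkew A)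
    {g : USphere n → ℂ} (hg : SphereSmooth g) {ψ : Euc n → ℂ} (hψ : ContDiff ℝ 1 ψ) :
    ∫ v, rotDeriv A g v * ψ v ∂(sphereProb n) =
      -∫ v, g v * fderiv ℝ ψ v (A v) ∂(sphereProb n) := by
  have hψc : Continuous fun v : USphere n => ψ v := hψ.continuous.comp continuous_subtype_val
  have hψc' : Continuous fun v : USphere n => fderiv ℝ ψ v (A v) :=
    ((hψ.continuous_fderiv (by simp)).comp continuous_subtype_val).clm_apply
      (A.continuous.comp continuous_subtype_val)
  have hgc' := (hg.rotDeriv A).continuous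
  have h := hasDerivAt_integral_comp_rot hA (H := fun v => g v * ψ v)
    (H' := fun v => rotDeriv A g v * ψ v + g v * fderiv ℝ ψ v (A v)) (w := fun _ => 1)
    (hg.continuous.mul hψc) ((hgc'.mul hψc).add (hg.continuous.mul hψc'))
    (fun v t => (hA.hasDerivAt_comp_sphereMap hg v t).mul
      (hA.hasDerivAt_comp_rot (F := ψ) (x := v) (t := t)
        (hψ.differentiable (by simp)).differentiableAt)) (integrable_const 1)
  simp only [mul_one] at h
  have hconst : (fun t => ∫ v, g (sphereMap (hA.rot t) v) * ψ (sphereMap (hA.rot t) v)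
      ∂(sphereProb n)) = fun _ => ∫ v, g v * ψ v ∂(sphereProb n) :=
    funext fun t => integral_sphereMap (hA.rot t) fun v => g v * ψ v
  rw [hconst] at h
  have h0 := h.unique (hasDerivAt_const _ _)
  have hi : ∀ {F : USphere n → ℂ}, Continuous F → Integrable F (sphereProb n) := fun hF => by
    simpa using integrable_mul_kernel hF (integrable_const (1 : ℂ))
  exact eq_neg_of_add_eq_zero_left
    ((integral_add (hi (hgc'.mul hψc)) (hi (hg.continuous.mul hψc'))).symm.trans h0)

/-- The adjoint form of the action of the spherical Laplacian on a zonal function `φ (u · v)`. -/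
theorem zonal_sphLap_of_contDiff {n : ℕ} [NeZero n] {g : USphere n → ℂ} (hg : SphereSmooth g)
    {φ : ℝ → ℂ} (hφ : ContDiff ℝ 2 φ) (u : USphere n) :
    zonal φ (sphLap g) u = zonal (fun t => (1 - t ^ 2 : ℝ) * deriv (deriv φ) t -
      (n - 1) * t * deriv φ t) g u := by
  have hφ1 : ContDiff ℝ 1 (deriv φ) := ContDiff.iterate_deriv' 1 1 hφ
  have hφ2 : Continuous (deriv (deriv φ)) := hφ1.continuous_deriv le_rfl
  let ℓ : Euc n →L[ℝ] ℝ := innerSL ℝ (u : Euc n)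
  have hℓ : ∀ v : USphere n, ℓ v = sdot u v := fun v => rfl
  -- Each generator `A` is integrated by parts twice, first against `φ (u · x)` and then against
  -- `φ' (u · x) (u · A x)`.
  have hparts : ∀ i j : Fin n, ∫ v, rotDeriv (rotGen i j) (rotDeriv (rotGen i j) g) v *
      φ (sdot u v) ∂(sphereProb n) = ∫ v, g v * (deriv (deriv φ) (sdot u v) *
        (ℓ (rotGen i j v) : ℂ) ^ 2 + deriv φ (sdot u v) * (ℓ (rotGen i j (rotGen i j v)) : ℂ))
          ∂(sphereProb n) := by
    intro i j
    set A := rotGen (n := n) i j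
    have hA : IsSkew A := isSkew_rotGen i j
    have hd1 : ∀ x : Euc n, fderiv ℝ (fun y => φ (ℓ y)) x (A x) =
        deriv φ (ℓ x) * (ℓ (A x) : ℂ) := by
      intro x
      have h := ((hφ.differentiable (by simp)).differentiableAt (x := ℓ x)).hasDerivAt.hasFDerivAt
        |>.comp x ℓ.hasFDerivAt
      have h' := h.fderiv
      simp only [Function.comp_def] at h'
      rw [h']
      simp [mul_comm]
    have hd2 : ∀ x : Euc n, fderiv ℝ (fun y => deriv φ (ℓ y) * (ℓ (A y) : ℂ)) x (A x) =
        deriv (deriv φ) (ℓ x) * (ℓ (A x) : ℂ) ^ 2 + deriv φ (ℓ x) * (ℓ (A (A x)) : ℂ) := by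
      intro x
      have h := ((hφ1.differentiable (by simp)).differentiableAt (x := ℓ x)).hasDerivAt.hasFDerivAt
        |>.comp x ℓ.hasFDerivAt
      have h3 : HasFDerivAt (fun y : Euc n => (ℓ (A y) : ℂ))
          (Complex.ofRealCLM ∘L (ℓ ∘L A)) x := (Complex.ofRealCLM ∘L (ℓ ∘L A)).hasFDerivAt
      have h' := (h.mul h3).fderiv
      simp only [Function.comp_def] at h'
      change fderiv ℝ ((fun y => deriv φ (ℓ y)) * fun y => (ℓ (A y) : ℂ)) x (A x) = _
      rw [h']
      simp
      ring
    have hC1 : ContDiff ℝ 1 fun y : Euc n => φ (ℓ y) :=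
      (hφ.of_le (by norm_num)).comp ℓ.contDiff
    have hC2 : ContDiff ℝ 1 fun y : Euc n => deriv φ (ℓ y) * (ℓ (A y) : ℂ) :=
      (hφ1.comp ℓ.contDiff).mul (Complex.ofRealCLM ∘L (ℓ ∘L A)).contDiff
    have e1 := integral_rotDeriv_mul hA (hg.rotDeriv A) hC1
    have e2 := integral_rotDeriv_mul hA hg hC2
    simp only [hd1, hd2] at e1 e2
    simp only [hℓ] at e1 e2
    rw [e1, e2, neg_neg]
  have hcont : ∀ i j : Fin n, Continuous fun v : USphere n => g v * (deriv (deriv φ) (sdot u v) *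
        (ℓ (rotGen i j v) : ℂ) ^ 2 +
          deriv φ (sdot u v) * (ℓ (rotGen i j (rotGen i j v)) : ℂ)) := by
    intro i j
    have hs := continuous_sdot u
    have hgc := hg.continuous
    have h1 := hφ2.comp hs
    have h2 := hφ1.continuous.comp hs
    have h3 : Continuous fun v : USphere n => (ℓ (rotGen i j v) : ℂ) :=
      (Complex.ofRealCLM ∘L (ℓ ∘L rotGen i j)).continuous.comp continuous_subtype_val
    have h4 : Continuous fun v : USphere n => (ℓ (rotGen i j (rotGen i j v)) : ℂ) :=
      (Complex.ofRealCLM ∘L (ℓ ∘L rotGen i j ∘L rotGen i j)).continuous.comp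
        continuous_subtype_val
    exact hgc.mul ((h1.mul (h3.pow 2)).add (h2.mul h4))
  have hi : ∀ {F : USphere n → ℂ}, Continuous F → Integrable F (sphereProb n) := fun hF => by
    simpa using integrable_mul_kernel hF (integrable_const (1 : ℂ))
  have hcont' : ∀ i j : Fin n, Continuous fun v : USphere n =>
      rotDeriv (rotGen i j) (rotDeriv (rotGen i j) g) v * φ (sdot u v) := fun i j =>
    ((hg.rotDeriv _).rotDeriv _).continuous.mul (hφ.continuous.comp (continuous_sdot u))
  have hL : zonal φ (sphLap g) u = (1 / 2 : ℂ) * ∑ i : Fin n, ∑ j : Fin n,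
      ∫ v, rotDeriv (rotGen i j) (rotDeriv (rotGen i j) g) v * φ (sdot u v) ∂(sphereProb n) := by
    simp_rw [← integral_finsetSum _ fun j _ => hi (hcont' _ j)]
    rw [← integral_finsetSum _ fun i _ => hi (continuous_finsetSum _ fun j _ => hcont' i j),
      ← integral_const_mul]
    simp only [zonal, sphLap, Finset.sum_mul, mul_assoc]
  rw [hL]
  simp_rw [hparts, ← integral_finsetSum _ fun j _ => hi (hcont _ j)]
  rw [← integral_finsetSum _ fun i _ => hi (continuous_finsetSum _ fun j _ => hcont i j),
      ← integral_const_mul]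
  refine integral_congr_ae (Filter.Eventually.of_forall fun v => ?_)
  -- The sums over the generators are the two parts of the Casimir operator, applied to `u · x`.
  have hs1 : ∑ i : Fin n, ∑ j : Fin n, (ℓ (rotGen i j v) : ℂ) ^ 2 =
      2 * (1 - (sdot u v : ℂ) ^ 2) := by
    have h := sum_bilin_rotGen (n := n)
      ((ContinuousLinearMap.mul ℝ ℂ).bilinearComp (Complex.ofRealCLM ∘L ℓ)
        (Complex.ofRealCLM ∘L ℓ)) v
    have h2 : ∑ i : Fin n, (ℓ (EuclideanSpace.single i 1) : ℂ) * ℓ (EuclideanSpace.single i 1)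
        = 1 := by
      have h3 := EuclideanSpace.real_norm_sq_eq (u : Euc n)
      rw [norm_eq_of_mem_sphere u] at h3
      simp only [ℓ, innerSL_apply_apply, EuclideanSpace.inner_single_right]
      have h4 : ((1 : ℝ) : ℂ) = ∑ i : Fin n, ((u : Euc n) i : ℂ) ^ 2 := by
        exact_mod_cast (by simpa using h3)
      simp only [one_mul, conj_trivial]
      rw [← Complex.ofReal_one, h4]
      exact Finset.sum_congr rfl fun i _ => (sq _).symm
    simp only [ContinuousLinearMap.bilinearComp_apply, ContinuousLinearMap.mul_apply',
      ContinuousLinearMap.comp_apply, Complex.ofRealCLM_apply, h2, hℓ, norm_eq_of_mem_sphere] at h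
    simp only [sq] at h ⊢
    simpa using h
  have hs2 : ∑ i : Fin n, ∑ j : Fin n, (ℓ (rotGen i j (rotGen i j v)) : ℂ) =
      -(2 * ((n : ℂ) - 1)) * sdot u v := by
    have h := congrArg (Complex.ofRealCLM ∘L ℓ) (sum_rotGen_rotGen (v : Euc n))
    simp only [map_sum, map_smul, ContinuousLinearMap.comp_apply, Complex.ofRealCLM_apply, hℓ]
      at h
    rw [h]; simp
  simp only [← Finset.mul_sum, Finset.sum_add_distrib, hs1, hs2]
  push_cast
  ring

/-! ### Smoothness of zonal transforms -/

theorem exists_annulus_cutoff (n : ℕ) : ∃ χ : Euc n → ℝ,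
    ContDiff ℝ ((⊤ : ℕ∞) : WithTop ℕ∞) χ ∧ (∀ᶠ y in nhds (0 : Euc n), χ y = 0) ∧
      (∀ v : USphere n, χ v = 1) ∧ ∀ y : Euc n, y ∉ Metric.closedBall (0 : Euc n) 2 → χ y = 0 := by
  let b₁ : ContDiffBump (0 : Euc n) := ⟨1, 2, by norm_num, by norm_num⟩
  let b₂ : ContDiffBump (0 : Euc n) := ⟨1 / 4, 1 / 2, by norm_num, by norm_num⟩
  refine ⟨fun y => b₁ y - b₂ y, b₁.contDiff.sub b₂.contDiff, ?_, fun v => ?_, fun y hy => ?_⟩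
  · filter_upwards [b₁.eventuallyEq_one, b₂.eventuallyEq_one] with y h1 h2
    simp [h1, h2]
  · have h1 : b₁ (v : Euc n) = 1 := b₁.one_of_mem_closedBall (by simp [b₁])
    have h2 : b₂ (v : Euc n) = 0 := b₂.zero_of_le_dist (by simp [b₂]; norm_num)
    simp [h1, h2]
  · have hy' : 2 < dist y 0 := by simpa using hy
    have h1 : b₁ y = 0 := b₁.zero_of_le_dist hy'.le
    have h2 : b₂ y = 0 := b₂.zero_of_le_dist (by simp only [b₂]; linarith)
    simp [h1, h2]

/-- An integral over the sphere depends smoothly on a parameter when the smooth factor of the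
integrand does. The factor is cut off to an annulus, so that the integral becomes a convolution with
a compactly supported smooth function, evaluated at `0`. -/
theorem contDiffOn_integral_sphere {n : ℕ} {s : Set (Euc n)} (hs : IsOpen s)
    {Φ : Euc n → Euc n → ℂ}
    (hΦ : ∀ p ∈ s, ∀ y ≠ 0, ContDiffAt ℝ ((⊤ : ℕ∞) : WithTop ℕ∞)
      (fun q : Euc n × Euc n => Φ q.1 q.2) (p, y))
    {K : Euc n → ℂ} (hK : Integrable (fun v : USphere n => K v) (sphereProb n)) :
    ContDiffOn ℝ ((⊤ : ℕ∞) : WithTop ℕ∞)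
      (fun x => ∫ v : USphere n, Φ x v * K v ∂(sphereProb n)) s := by
  obtain ⟨χ, hχ, hχ0, hχ1, hχ2⟩ := exists_annulus_cutoff n
  let G : Euc n → Euc n → ℂ := fun p y => (χ (-y) : ℂ) * Φ p (-y)
  have hG : ContDiffOn ℝ ((⊤ : ℕ∞) : WithTop ℕ∞) (↿G) (s ×ˢ Set.univ) := by
    rintro ⟨p, y⟩ ⟨hp, -⟩
    have hp : p ∈ s := hp
    refine ContDiffAt.contDiffWithinAt ?_
    by_cases hy : y = 0
    · subst hy
      have h0 : (↿G) =ᶠ[nhds (p, 0)] fun _ => 0 := by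
        have hc : Filter.Tendsto (fun q : Euc n × Euc n => -q.2) (nhds (p, 0)) (nhds 0) := by
          have : Continuous fun q : Euc n × Euc n => -q.2 := continuous_snd.neg
          simpa using this.tendsto (p, (0 : Euc n))
        filter_upwards [hc.eventually hχ0] with q hq
        simp [Function.HasUncurry.uncurry, G, hq]
      exact contDiffAt_const.congr_of_eventuallyEq h0
    · have hχ' : ContDiffAt ℝ ((⊤ : ℕ∞) : WithTop ℕ∞)
          (fun q : Euc n × Euc n => (χ (-q.2) : ℂ)) (p, y) :=
        (Complex.ofRealCLM.contDiff.comp (hχ.comp contDiff_snd.neg)).contDiffAt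
      have hΦ' : ContDiffAt ℝ ((⊤ : ℕ∞) : WithTop ℕ∞)
          (fun q : Euc n × Euc n => Φ q.1 (-q.2)) (p, y) :=
        ContDiffAt.comp (g := fun q : Euc n × Euc n => Φ q.1 q.2)
          (f := fun q : Euc n × Euc n => (q.1, -q.2)) (p, y)
          (hΦ p hp (-y) (neg_ne_zero.2 hy)) (contDiffAt_fst.prodMk contDiffAt_snd.neg)
      exact hχ'.mul hΦ'
  let μ : Measure (Euc n) := (sphereProb n).map Subtype.val
  have hemb : MeasurableEmbedding (Subtype.val : USphere n → Euc n) :=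
    MeasurableEmbedding.subtype_coe Metric.isClosed_sphere.measurableSet
  have hint : Integrable K μ := hemb.integrable_map_iff.2 hK
  have hcomp := contDiffOn_convolution_right_with_param_comp (μ := μ) (n := ⊤)
    (ContinuousLinearMap.mul ℝ ℂ) (v := fun _ => (0 : Euc n)) contDiffOn_const hs
    (isCompact_closedBall (0 : Euc n) 2) (g := G) (fun p y _ hy => by
      have := hχ2 (-y) (by simpa using hy)
      simp [G, this]) hint.locallyIntegrable hG
  refine hcomp.congr fun x hx => ?_
  rw [convolution_def, hemb.integral_map]
  refine integral_congr_ae (Filter.Eventually.of_forall fun v => ?_)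
  simp only [G, ContinuousLinearMap.mul_apply', zero_sub, neg_neg, hχ1, Complex.ofReal_one,
    one_mul]
  rw [mul_comm]

/-- A zonal transform of a smooth function is smooth, however singular the (integrable) kernel is.
Near a point `u₀`, the integral is pulled back by the reflection that maps `x/|x|` to `-u₀`. It
depends smoothly on `x`, the kernel becomes independent of `x`, and all derivatives fall on `g`. -/
theorem SphereSmooth.zonal {n : ℕ} {g : USphere n → ℂ} (hg : SphereSmooth g) {k : ℝ → ℂ}
    (hk : ∀ u, Integrable (fun v => k (sdot u v)) (sphereProb n)) : SphereSmooth (zonal k g) := by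
  refine contDiffOn_of_locally_contDiffOn fun x₀ hx₀ => ?_
  set u₀ := direction x₀ hx₀ with hu₀
  let s : Set (Euc n) := {x | 0 < inner ℝ (u₀ : Euc n) x}
  have hs : IsOpen s := isOpen_lt continuous_const (continuous_const.inner continuous_id)
  have hs0 : ∀ x ∈ s, x ≠ 0 := by
    rintro x hx rfl
    simp [s] at hx
  refine ⟨s, hs, ?_, ?_⟩
  · have : 0 < ‖x₀‖⁻¹ * ‖x₀‖ ^ 2 := by
      have := norm_pos_iff.2 hx₀; positivity
    simpa [s, hu₀, direction, inner_smul_left] using this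
  -- `W x` spans the line orthogonal to the mirror of the reflection. The target `-u₀` is far from
  -- `x/|x|`, so that `W x` does not vanish; with `u₀` as target it would vanish at `x₀`.
  let W : Euc n → Euc n := fun x => ‖x‖⁻¹ • x - (-u₀ : USphere n)
  have hW : ∀ x ∈ s, W x ≠ 0 := by
    intro x hx h
    have h1 : inner ℝ (u₀ : Euc n) (W x) = ‖x‖⁻¹ * inner ℝ (u₀ : Euc n) x + 1 := by
      simp [W, inner_add_right, inner_smul_right]
    rw [h, inner_zero_right] at h1
    have : 0 < inner ℝ (u₀ : Euc n) x := hx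
    have : 0 ≤ ‖x‖⁻¹ * inner ℝ (u₀ : Euc n) x := by positivity
    linarith
  let R : Euc n → Euc n ≃ₗᵢ[ℝ] Euc n := fun x => (ℝ ∙ W x)ᗮ.reflection
  have hR : ∀ x y, R x y = y - (2 * (inner ℝ (W x) y / ‖W x‖ ^ 2)) • W x := by
    intro x y
    simp only [R, Submodule.reflection_orthogonal_apply, Submodule.reflection_singleton_apply]
    simp [two_smul, two_mul, add_smul]
  have hRdir : ∀ x (hx : x ∈ s), sphereMap (R x) (direction x (hs0 x hx)) = -u₀ := by
    intro x hx
    have h := Submodule.reflection_sub (F := Euc n) (v := direction x (hs0 x hx)) (w := -u₀)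
      (by simp)
    exact Subtype.ext h
  have hRR : ∀ x (v : USphere n), sphereMap (R x) (sphereMap (R x) v) = v := fun x v =>
    Subtype.ext (Submodule.reflection_reflection _ _)
  have hrep : ∀ x ∈ s, homExt 0 (CosineTransform.zonal k g) x =
      ∫ v, g (sphereMap (R x) v) * k (sdot (-u₀) v) ∂(sphereProb n) := by
    intro x hx
    rw [homExt_zero_of_ne _ (hs0 x hx), ← hRR x (direction x (hs0 x hx)), zonal_sphereMap,
      hRdir x hx]
  have hsm : ∀ p ∈ s, ∀ y ≠ 0, ContDiffAt ℝ ((⊤ : ℕ∞) : WithTop ℕ∞)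
      (fun q : Euc n × Euc n => homExt 0 g (R q.1 q.2)) (p, y) := by
    intro p hp y hy
    have hWs : ContDiffAt ℝ ((⊤ : ℕ∞) : WithTop ℕ∞) (fun q : Euc n × Euc n => W q.1) (p, y) :=
      (((contDiffAt_fst.norm ℝ (hs0 p hp)).inv (norm_ne_zero_iff.2 (hs0 p hp))).smul
        contDiffAt_fst).sub contDiffAt_const
    have hRs : ContDiffAt ℝ ((⊤ : ℕ∞) : WithTop ℕ∞)
        (fun q : Euc n × Euc n => R q.1 q.2) (p, y) := by
      simp only [hR]
      refine contDiffAt_snd.sub (ContDiffAt.smul (contDiffAt_const.mul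
        ((hWs.inner ℝ contDiffAt_snd).div (hWs.norm_sq ℝ) ?_)) hWs)
      simpa using hW p hp
    have hne : R p y ≠ 0 := by simpa using hy
    exact ContDiffAt.comp (g := homExt 0 g) (f := fun q : Euc n × Euc n => R q.1 q.2) (p, y)
      (hg.contDiffAt hne) hRs
  have hfin := contDiffOn_integral_sphere hs (Φ := fun p y => homExt 0 g (R p y)) hsm
    (K := fun y => k (inner ℝ ((-u₀ : USphere n) : Euc n) y)) (hk (-u₀))
  refine (hfin.mono Set.inter_subset_right).congr fun x hx => ?_
  rw [hrep x hx.2]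
  refine integral_congr_ae (Filter.Eventually.of_forall fun v => ?_)
  have := homExt_coe 0 g (sphereMap (R x) v)
  rw [coe_sphereMap] at this
  simp only [this]
  rfl

theorem sphLap_zonal {n : ℕ} {g : USphere n → ℂ} (hg : SphereSmooth g) {k : ℝ → ℂ}
    (hk : ∀ u, Integrable (fun v => k (sdot u v)) (sphereProb n)) :
    sphLap (zonal k g) = zonal k (sphLap g) := by
  have hL : ∀ i j, rotDeriv (rotGen i j) (rotDeriv (rotGen i j) (zonal k g)) =
      zonal k (rotDeriv (rotGen i j) (rotDeriv (rotGen i j) g)) := by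
    intro i j
    have hA : IsSkew (rotGen (n := n) i j) := isSkew_rotGen i j
    have h1 : ∀ {h : USphere n → ℂ}, SphereSmooth h →
        rotDeriv (rotGen i j) (zonal k h) = zonal k (rotDeriv (rotGen i j) h) := fun hh =>
      funext fun u => rotDeriv_zonal hA hh (hh.zonal hk) u (hk u)
    rw [h1 hg, h1 (hg.rotDeriv _)]
  have hi : ∀ i j u, Integrable (fun v => rotDeriv (rotGen i j) (rotDeriv (rotGen i j) g) v *
      k (sdot u v)) (sphereProb n) := fun i j u =>
    integrable_mul_kernel ((hg.rotDeriv _).rotDeriv _).continuous (hk u)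
  funext u
  simp only [sphLap, hL, zonal, mul_assoc, Finset.sum_mul]
  rw [integral_const_mul, integral_finsetSum _ fun i _ => integrable_finsetSum _ fun j _ => hi i j u]
  simp_rw [integral_finsetSum _ fun j _ => hi _ j u]

/-! ### Power kernels -/

/-- The kernel `|t|^λ`. -/
noncomputable def powKernel (lam : ℂ) (t : ℝ) : ℂ := ((|t| : ℝ) : ℂ) ^ lam

theorem powKernel_ofReal (s t : ℝ) : powKernel s t = ((|t| ^ s : ℝ) : ℂ) :=
  (Complex.ofReal_cpow (abs_nonneg t) s).symm

theorem norm_powKernel {t : ℝ} (ht : t ≠ 0) (lam : ℂ) : ‖powKernel lam t‖ = |t| ^ lam.re :=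
  Complex.norm_cpow_eq_rpow_re_of_pos (abs_pos.2 ht) lam

theorem hasDerivAt_powKernel {t : ℝ} (ht : t ≠ 0) (lam : ℂ) :
    HasDerivAt (fun z => powKernel z t) ((Real.log |t| : ℂ) * powKernel lam t) lam := by
  have h := (hasDerivAt_id lam).const_cpow (c := ((|t| : ℝ) : ℂ)) (Or.inl (by simpa using ht))
  rw [Complex.ofReal_log (abs_nonneg t), mul_comm]
  simpa [powKernel] using h

theorem hasDerivAt_zonal_powKernel {n : ℕ} [NeZero n] {g : USphere n → ℂ} (hg : Continuous g)
    (u : USphere n) {lam : ℂ} (hlam : -1 < lam.re) :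
    HasDerivAt (fun z => zonal (powKernel z) g u)
      (∫ v, g v * ((Real.log |sdot u v| : ℂ) * powKernel lam (sdot u v)) ∂(sphereProb n)) lam := by
  obtain ⟨M, hM⟩ := exists_norm_le_of_continuous hg
  -- One `δ` of the margin above `-1` goes to the ball around `λ`, one to the logarithm.
  set δ : ℝ := (lam.re + 1) / 3 with hδ
  have hδ0 : 0 < δ := by rw [hδ]; linarith
  have hre : ∀ z ∈ Metric.ball lam δ, -1 + 2 * δ ≤ z.re := by
    intro z hz
    have h1 := (Complex.abs_re_le_norm (z - lam)).trans_lt (mem_ball_iff_norm.1 hz)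
    rw [Complex.sub_re] at h1
    have h2 := (abs_lt.1 h1).1
    have h3 : lam.re = 3 * δ - 1 := by rw [hδ]; ring
    linarith
  have hint : ∀ z : ℂ, -1 < z.re →
      Integrable (fun v => g v * powKernel z (sdot u v)) (sphereProb n) := fun z hz =>
    integrable_mul_kernel hg (integrable_abs_sdot_cpow u hz)
  have hmeas' : AEStronglyMeasurable
      (fun v => g v * ((Real.log |sdot u v| : ℂ) * powKernel lam (sdot u v))) (sphereProb n) :=
    hg.aestronglyMeasurable.mul
      ((Complex.measurable_ofReal.comp (continuous_sdot u).abs.measurable.log).mul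
        (measurable_abs_sdot_cpow u lam)).aestronglyMeasurable
  refine (hasDerivAt_integral_of_dominated_loc_of_deriv_le (μ := sphereProb n)
    (F := fun z v => g v * powKernel z (sdot u v))
    (F' := fun z v => g v * ((Real.log |sdot u v| : ℂ) * powKernel z (sdot u v)))
    (bound := fun v => M * (|sdot u v| ^ (-1 + δ) / δ)) (x₀ := lam)
    (Metric.ball_mem_nhds lam hδ0) ?_ (hint lam hlam) hmeas' ?_
    (((integrable_abs_sdot_rpow u (by linarith)).div_const δ).const_mul M) ?_).2
  · filter_upwards [Metric.ball_mem_nhds lam hδ0] with z hz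
    exact (hint z (by linarith [hre z hz])).aestronglyMeasurable
  · filter_upwards [ae_sdot_ne_zero u] with v hv z hz
    have ht : 0 < |sdot u v| := abs_pos.2 hv
    have ht1 := abs_sdot_le_one u v
    rw [norm_mul, norm_mul, norm_powKernel hv, Complex.norm_real, Real.norm_eq_abs]
    have hM0 : 0 ≤ M := (norm_nonneg _).trans (hM v)
    refine mul_le_mul (hM v) ?_ (by positivity) hM0
    calc |Real.log (|sdot u v|)| * |sdot u v| ^ z.re
        ≤ (|sdot u v| ^ (-δ) / δ) * |sdot u v| ^ (-1 + 2 * δ) :=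
          mul_le_mul (abs_log_le_rpow ht ht1 hδ0)
            (Real.rpow_le_rpow_of_exponent_ge ht ht1 (hre z hz)) (by positivity) (by positivity)
      _ = |sdot u v| ^ (-1 + δ) / δ := by
          rw [div_mul_eq_mul_div, ← Real.rpow_add ht]; congr 2; ring
  · filter_upwards [ae_sdot_ne_zero u] with v hv z _
    exact (hasDerivAt_powKernel hv z).const_mul (g v)

theorem integral_sphLap {n : ℕ} [NeZero n] {g : USphere n → ℂ} (hg : SphereSmooth g) :
    ∫ v, sphLap g v ∂(sphereProb n) = 0 := by
  let e : USphere n := ⟨EuclideanSpace.single 0 1, by simp⟩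
  simpa [zonal] using zonal_sphLap_of_contDiff hg (φ := fun _ => 1) contDiff_const e

theorem hasDerivAt_abs_rpow_mul (t : ℝ) {p : ℝ} (hp : 1 < p) :
    HasDerivAt (fun t : ℝ => |t| ^ p * t) ((p + 1) * |t| ^ p) t := by
  have h := (hasDerivAt_abs_rpow t hp).mul (hasDerivAt_id t)
  have he : p * |t| ^ (p - 2) * t * t = p * |t| ^ p := by
    rcases eq_or_ne t 0 with rfl | ht
    · simp [Real.zero_rpow (by linarith : p ≠ 0)]
    · have hp2 : |t| ^ p = |t| ^ (p - 2) * |t| ^ 2 := by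
        rw [← Real.rpow_natCast, ← Real.rpow_add (abs_pos.2 ht)]; congr 1; push_cast; ring
      rw [hp2, sq_abs]; ring
  refine h.congr_deriv ?_
  simp only [id, mul_one]
  rw [he]; ring

/-- The relation between the power kernels of degree `λ` and `λ + 2`, for large real `λ`. -/
theorem zonal_powKernel_recursion_ofReal {n : ℕ} [NeZero n] {g : USphere n → ℂ}
    (hg : SphereSmooth g) (u : USphere n) {s : ℝ} (hs : 1 < s) :
    ((s : ℂ) + 2) * (s + 1) * zonal (powKernel s) g u =
      zonal (powKernel ((s : ℂ) + 2)) (sphLap g) u +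
        ((s : ℂ) + 2) * (s + n) * zonal (powKernel ((s : ℂ) + 2)) g u := by
  have hcast : ((s : ℂ) + 2) = ((s + 2 : ℝ) : ℂ) := by push_cast; rfl
  have hd1 : ∀ t, HasDerivAt (fun t : ℝ => powKernel ((s : ℂ) + 2) t)
      (((s + 2) * (|t| ^ s * t) : ℝ) : ℂ) t := by
    intro t
    simp_rw [hcast, powKernel_ofReal]
    convert (hasDerivAt_abs_rpow t (by linarith : 1 < s + 2)).ofReal_comp using 2
    rw [add_sub_cancel_right]; ring
  have hderiv1 : deriv (fun t : ℝ => powKernel ((s : ℂ) + 2) t) =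
      fun t => (((s + 2) * (|t| ^ s * t) : ℝ) : ℂ) := funext fun t => (hd1 t).deriv
  have hd2 : ∀ t, HasDerivAt (fun t : ℝ => (((s + 2) * (|t| ^ s * t) : ℝ) : ℂ))
      (((s + 2) * ((s + 1) * |t| ^ s) : ℝ) : ℂ) t := fun t =>
    ((hasDerivAt_abs_rpow_mul t hs).const_mul (s + 2)).ofReal_comp
  have hderiv2 : deriv (fun t : ℝ => (((s + 2) * (|t| ^ s * t) : ℝ) : ℂ)) =
      fun t => (((s + 2) * ((s + 1) * |t| ^ s) : ℝ) : ℂ) := funext fun t => (hd2 t).deriv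
  have hc : Continuous fun t : ℝ => (((s + 2) * ((s + 1) * |t| ^ s) : ℝ) : ℂ) :=
    Complex.continuous_ofReal.comp (continuous_const.mul (continuous_const.mul
      (continuous_abs.rpow_const fun _ => Or.inr (by linarith))))
  have hC1 : ContDiff ℝ 1 fun t : ℝ => (((s + 2) * (|t| ^ s * t) : ℝ) : ℂ) :=
    contDiff_one_iff_deriv.2 ⟨fun t => (hd2 t).differentiableAt, by rw [hderiv2]; exact hc⟩
  have hC2 : ContDiff ℝ 2 fun t : ℝ => powKernel ((s : ℂ) + 2) t := by
    rw [show (2 : WithTop ℕ∞) = 1 + 1 by norm_num, contDiff_succ_iff_deriv]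
    exact ⟨fun t => (hd1 t).differentiableAt, by simp, by rw [hderiv1]; exact hC1⟩
  have h := zonal_sphLap_of_contDiff hg hC2 u
  simp only [hderiv1, hderiv2] at h
  have hi : ∀ r : ℝ, -1 < r →
      Integrable (fun v => g v * powKernel r (sdot u v)) (sphereProb n) := fun r hr =>
    integrable_mul_kernel hg.continuous (integrable_abs_sdot_cpow u (by simpa using hr))
  have hker : ∀ t : ℝ, ((1 - t ^ 2 : ℝ) : ℂ) * (((s + 2) * ((s + 1) * |t| ^ s) : ℝ) : ℂ) -
      (n - 1) * t * (((s + 2) * (|t| ^ s * t) : ℝ) : ℂ) =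
      ((s : ℂ) + 2) * (s + 1) * powKernel s t -
        ((s : ℂ) + 2) * (s + n) * powKernel ((s : ℂ) + 2) t := by
    intro t
    have he : |t| ^ (s + 2) = |t| ^ s * t ^ 2 := by
      rcases eq_or_ne t 0 with rfl | ht
      · simp [Real.zero_rpow (by linarith : s + 2 ≠ 0)]
      · rw [Real.rpow_add (abs_pos.2 ht), ← sq_abs t]; norm_num
    rw [hcast, powKernel_ofReal, powKernel_ofReal, he]
    push_cast
    ring
  have hz : zonal (fun t => ((1 - t ^ 2 : ℝ) : ℂ) * (((s + 2) * ((s + 1) * |t| ^ s) : ℝ) : ℂ) -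
      (n - 1) * t * (((s + 2) * (|t| ^ s * t) : ℝ) : ℂ)) g u =
      ((s : ℂ) + 2) * (s + 1) * zonal (powKernel s) g u -
        ((s : ℂ) + 2) * (s + n) * zonal (powKernel ((s : ℂ) + 2)) g u := by
    have hi2 := hi (s + 2) (by linarith)
    rw [← hcast] at hi2
    simp only [zonal]
    rw [← integral_const_mul, ← integral_const_mul,
      ← integral_sub ((hi s (by linarith)).const_mul _) (hi2.const_mul _)]
    refine integral_congr_ae (Filter.Eventually.of_forall fun v => ?_)
    simp only [hker]
    ring
  change zonal (powKernel ((s : ℂ) + 2)) (sphLap g) u = _ at h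
  rw [h, hz]
  ring

theorem isOpen_re_gt (a : ℝ) : IsOpen {z : ℂ | a < z.re} :=
  isOpen_lt continuous_const Complex.continuous_re

theorem isPreconnected_re_gt (a : ℝ) : IsPreconnected {z : ℂ | a < z.re} :=
  (convex_halfSpace_re_gt a).isPreconnected

theorem zonal_powKernel_recursion {n : ℕ} [NeZero n] {g : USphere n → ℂ}
    (hg : SphereSmooth g) (u : USphere n) {lam : ℂ} (hlam : -1 < lam.re) :
    (lam + 2) * (lam + 1) * zonal (powKernel lam) g u =
      zonal (powKernel (lam + 2)) (sphLap g) u +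
        (lam + 2) * (lam + n) * zonal (powKernel (lam + 2)) g u := by
  have hd : ∀ {f : USphere n → ℂ}, SphereSmooth f → ∀ z : ℂ, -1 < z.re →
      DifferentiableAt ℂ (fun w => zonal (powKernel w) f u) z := fun hf z hz =>
    (hasDerivAt_zonal_powKernel hf.continuous u hz).differentiableAt
  have hd2 : ∀ {f : USphere n → ℂ}, SphereSmooth f → ∀ z : ℂ, -1 < z.re →
      DifferentiableAt ℂ (fun w => zonal (powKernel (w + 2)) f u) z := by
    intro f hf z hz
    exact DifferentiableAt.comp (g := fun w => zonal (powKernel w) f u) (f := fun w => w + 2) z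
      (hd hf (z + 2) (by simp; linarith)) (by fun_prop)
  have hL : AnalyticOnNhd ℂ (fun z => (z + 2) * (z + 1) * zonal (powKernel z) g u)
      {z : ℂ | -1 < z.re} := by
    refine DifferentiableOn.analyticOnNhd (fun z hz => ?_) (isOpen_re_gt _)
    have := hd hg z hz
    exact DifferentiableAt.differentiableWithinAt (by fun_prop)
  have hR : AnalyticOnNhd ℂ (fun z => zonal (powKernel (z + 2)) (sphLap g) u +
      (z + 2) * (z + n) * zonal (powKernel (z + 2)) g u) {z : ℂ | -1 < z.re} := by
    refine DifferentiableOn.analyticOnNhd (fun z hz => ?_) (isOpen_re_gt _)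
    have h1 := hd2 hg z hz
    have h2 := hd2 hg.sphLap z hz
    exact DifferentiableAt.differentiableWithinAt (by fun_prop)
  -- Real points accumulate at `2`.
  refine hL.eqOn_of_preconnected_of_frequently_eq hR (isPreconnected_re_gt _) (z₀ := 2)
    (by simp only [Set.mem_ofPred_eq, Complex.re_ofNat]; norm_num) ?_ hlam
  have ht : Filter.Tendsto (fun s : ℝ => (s : ℂ)) (nhdsWithin 2 {2}ᶜ) (nhdsWithin 2 {2}ᶜ) := by
    refine tendsto_nhdsWithin_iff.2 ⟨?_, ?_⟩
    · exact (Complex.continuous_ofReal.tendsto' (2 : ℝ) 2 (by simp)).mono_left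
        nhdsWithin_le_nhds
    · filter_upwards [self_mem_nhdsWithin] with s hs h
      exact hs (Complex.ofReal_injective (by simpa using h))
  have hev : ∀ᶠ s : ℝ in nhdsWithin 2 {2}ᶜ, 1 < s :=
    nhdsWithin_le_nhds (lt_mem_nhds (by norm_num))
  exact ht.frequently (hev.mono fun s hs => zonal_powKernel_recursion_ofReal hg u hs).frequently

/-! ### Analytic continuation of the power transforms -/

/-- The function `π^{1/2} / (Γ(n/2) Γ((λ+1)/2)) ∫ g(v) |u · v|^λ d_*v`, that is, the normalized
cosine transform without the factor `Γ(-λ/2)`, which carries its poles. -/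
noncomputable def regTransform {n : ℕ} (g : USphere n → ℂ) (u : USphere n) (lam : ℂ) : ℂ :=
  (Real.sqrt Real.pi : ℂ) * (Complex.Gamma ((n : ℂ) / 2))⁻¹ *
    (Complex.Gamma ((lam + 1) / 2))⁻¹ * zonal (powKernel lam) g u

theorem differentiableAt_regTransform {n : ℕ} [NeZero n] {g : USphere n → ℂ}
    (hg : SphereSmooth g) (u : USphere n) {lam : ℂ} (hlam : -1 < lam.re) :
    DifferentiableAt ℂ (regTransform g u) lam := by
  have h1 := (hasDerivAt_zonal_powKernel hg.continuous u hlam).differentiableAt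
  have h2 : DifferentiableAt ℂ (fun z : ℂ => (Complex.Gamma ((z + 1) / 2))⁻¹) lam :=
    (Complex.differentiable_one_div_Gamma.comp
      (by fun_prop : Differentiable ℂ fun z : ℂ => (z + 1) / 2)) lam
  exact (h2.const_mul _).mul h1

theorem regTransform_recursion {n : ℕ} [NeZero n] {g : USphere n → ℂ} (hg : SphereSmooth g)
    (u : USphere n) {lam : ℂ} (hlam : -1 < lam.re) :
    2 * (lam + 2) * regTransform g u lam = regTransform (sphLap g) u (lam + 2) +
      (lam + 2) * (lam + n) * regTransform g u (lam + 2) := by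
  have hne : (lam + 1) / 2 ≠ 0 := by
    intro h
    have h1 : lam = -1 := by linear_combination 2 * h
    rw [h1] at hlam
    simp at hlam
  have hG : (Complex.Gamma ((lam + 1) / 2))⁻¹ =
      (lam + 1) / 2 * (Complex.Gamma ((lam + 2 + 1) / 2))⁻¹ := by
    rw [show (lam + 2 + 1) / 2 = (lam + 1) / 2 + 1 by ring, Complex.Gamma_add_one _ hne, mul_inv,
      mul_inv_cancel_left₀ hne]
  have h := zonal_powKernel_recursion hg u hlam
  simp only [regTransform]
  rw [hG]
  linear_combination ((Real.sqrt Real.pi : ℂ) * (Complex.Gamma ((n : ℂ) / 2))⁻¹ *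
    (Complex.Gamma ((lam + 2 + 1) / 2))⁻¹) * h

theorem zonal_powKernel_zero {n : ℕ} (g : USphere n → ℂ) (u : USphere n) :
    zonal (powKernel 0) g u = ∫ v, g v ∂(sphereProb n) := by
  simp [zonal, powKernel]

theorem regTransform_zero {n : ℕ} {g : USphere n → ℂ}
    (hmean : ∫ v, g v ∂(sphereProb n) = 0) (u : USphere n) : regTransform g u 0 = 0 := by
  rw [regTransform, zonal_powKernel_zero, hmean, mul_zero]

/-- One step of the recursion moves the boundary of the half-plane of holomorphy by `2`. The
division by `λ + 2` is harmless because the transform of `sphLap g` vanishes at `0`. -/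
theorem exists_continuation_halfPlane {n : ℕ} [NeZero n] (u : USphere n) (m : ℕ) :
    ∀ g : USphere n → ℂ, SphereSmooth g → ∃ h : ℂ → ℂ,
      DifferentiableOn ℂ h {z | -1 - 2 * (m : ℝ) < z.re} ∧
        ∀ z : ℂ, -1 < z.re → h z = regTransform g u z := by
  induction m with
  | zero =>
    intro g hg
    refine ⟨regTransform g u, fun z hz => ?_, fun _ _ => rfl⟩
    exact (differentiableAt_regTransform hg u (by simpa using hz)).differentiableWithinAt
  | succ m ih =>
    intro g hg
    obtain ⟨h₁, hd₁, he₁⟩ := ih (sphLap g) hg.sphLap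
    obtain ⟨h₂, hd₂, he₂⟩ := ih g hg
    have hmaps : Set.MapsTo (fun z : ℂ => z + 2) {z | -1 - 2 * ((m + 1 : ℕ) : ℝ) < z.re}
        {z | -1 - 2 * (m : ℝ) < z.re} := by
      intro z hz
      have hz' : -1 - 2 * ((m + 1 : ℕ) : ℝ) < z.re := hz
      push_cast at hz'
      simp only [Set.mem_ofPred_eq, Complex.add_re, Complex.re_ofNat]
      linarith
    have h0 : {z : ℂ | -1 - 2 * (m : ℝ) < z.re} ∈ nhds (0 : ℂ) := by
      refine (isOpen_re_gt _).mem_nhds ?_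
      have : (0 : ℝ) ≤ m := m.cast_nonneg
      simp only [Set.mem_ofPred_eq, Complex.zero_re]
      linarith
    have hds := (Complex.differentiableOn_dslope h0).2 hd₁
    refine ⟨fun z => (1 / 2) * (dslope h₁ 0 (z + 2) + (z + n) * h₂ (z + 2)), ?_, ?_⟩
    · have hadd : DifferentiableOn ℂ (fun z : ℂ => z + 2)
          {z | -1 - 2 * ((m + 1 : ℕ) : ℝ) < z.re} := by fun_prop
      exact ((hds.comp hadd hmaps).add
        ((differentiableOn_id.add_const _).mul (hd₂.comp hadd hmaps))).const_mul _
    · intro z hz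
      have hz2 : -1 < (z + 2).re := by simp only [Complex.add_re, Complex.re_ofNat]; linarith
      have hne : z + 2 ≠ 0 := by
        intro h
        have h1 : z = -2 := by linear_combination h
        rw [h1] at hz
        norm_num at hz
      have hrec := regTransform_recursion hg u hz
      have hz0 : h₁ 0 = 0 := by
        rw [he₁ 0 (by simp), regTransform_zero (integral_sphLap hg)]
      beta_reduce
      rw [dslope_of_ne _ hne, slope_def_field, hz0, he₁ _ hz2, he₂ _ hz2]
      field_simp
      linear_combination -hrec

/-- The partial continuations agree by the identity theorem, hence define an entire function. -/
theorem exists_entire_continuation {n : ℕ} [NeZero n] (u : USphere n) {g : USphere n → ℂ}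
    (hg : SphereSmooth g) : ∃ H : ℂ → ℂ, Differentiable ℂ H ∧
      ∀ z : ℂ, -1 < z.re → H z = regTransform g u z := by
  choose h hd he using fun m => exists_continuation_halfPlane u m g hg
  have hmem0 : ∀ m : ℕ, (0 : ℂ) ∈ {z : ℂ | -1 - 2 * (m : ℝ) < z.re} := by
    intro m
    have : (0 : ℝ) ≤ m := m.cast_nonneg
    simp only [Set.mem_ofPred_eq, Complex.zero_re]
    linarith
  have hmono : ∀ m k : ℕ, m ≤ k → ∀ z : ℂ, -1 - 2 * (m : ℝ) < z.re → h m z = h k z := by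
    intro m k hmk z hz
    have hsub : {z : ℂ | -1 - 2 * (m : ℝ) < z.re} ⊆ {z | -1 - 2 * (k : ℝ) < z.re} := by
      intro w hw
      have h1 : -1 - 2 * (m : ℝ) < w.re := hw
      have h2 : (m : ℝ) ≤ k := by exact_mod_cast hmk
      simp only [Set.mem_ofPred_eq]
      linarith
    refine ((hd m).analyticOnNhd (isOpen_re_gt _)).eqOn_of_preconnected_of_eventuallyEq
      (((hd k).mono hsub).analyticOnNhd (isOpen_re_gt _)) (isPreconnected_re_gt _) (hmem0 m) ?_ hz
    filter_upwards [(isOpen_re_gt (-1)).mem_nhds (by simp : (0 : ℂ) ∈ {z : ℂ | -1 < z.re})]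
      with w hw
    rw [he m w hw, he k w hw]
  have heq : ∀ m k : ℕ, ∀ z : ℂ, -1 - 2 * (m : ℝ) < z.re → -1 - 2 * (k : ℝ) < z.re →
      h m z = h k z := by
    intro m k z hm hk
    rcases le_total m k with hmk | hmk
    · exact hmono m k hmk z hm
    · exact (hmono k m hmk z hk).symm
  have hN : ∀ z : ℂ, -1 - 2 * ((⌈|z.re|⌉₊ : ℕ) : ℝ) < z.re := by
    intro z
    have h1 := Nat.le_ceil |z.re|
    have h2 := neg_abs_le z.re
    have h3 := abs_nonneg z.re
    linarith
  refine ⟨fun z => h ⌈|z.re|⌉₊ z, fun z => ?_, fun z hz => he _ z hz⟩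
  have hz := (isOpen_re_gt _).mem_nhds (hN z)
  refine ((hd _).differentiableAt hz).congr_of_eventuallyEq ?_
  filter_upwards [hz] with w hw
  exact heq _ _ w (hN w) hw

/-- The entire continuation of `regTransform g u`. -/
noncomputable def entireTransform {n : ℕ} [NeZero n] {g : USphere n → ℂ} (hg : SphereSmooth g)
    (u : USphere n) : ℂ → ℂ :=
  (exists_entire_continuation u hg).choose

theorem differentiable_entireTransform {n : ℕ} [NeZero n] {g : USphere n → ℂ}
    (hg : SphereSmooth g) (u : USphere n) : Differentiable ℂ (entireTransform hg u) :=
  (exists_entire_continuation u hg).choose_spec.1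

theorem entireTransform_eq {n : ℕ} [NeZero n] {g : USphere n → ℂ} (hg : SphereSmooth g)
    (u : USphere n) {z : ℂ} (hz : -1 < z.re) : entireTransform hg u z = regTransform g u z :=
  (exists_entire_continuation u hg).choose_spec.2 z hz

theorem entireTransform_recursion {n : ℕ} [NeZero n] {g : USphere n → ℂ} (hg : SphereSmooth g)
    (u : USphere n) (lam : ℂ) :
    2 * (lam + 2) * entireTransform hg u lam = entireTransform hg.sphLap u (lam + 2) +
      (lam + 2) * (lam + n) * entireTransform hg u (lam + 2) := by
  have d1 := differentiable_entireTransform hg u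
  have d2 := differentiable_entireTransform hg.sphLap u
  have e1 : Differentiable ℂ fun z => 2 * (z + 2) * entireTransform hg u z := by fun_prop
  have e2 : Differentiable ℂ fun z => entireTransform hg.sphLap u (z + 2) +
      (z + 2) * (z + n) * entireTransform hg u (z + 2) := by fun_prop
  refine congrFun (AnalyticOnNhd.eq_of_eventuallyEq (z₀ := 0) (fun z _ => e1.analyticAt z)
    (fun z _ => e2.analyticAt z) ?_) lam
  filter_upwards [(isOpen_re_gt (-1)).mem_nhds (by simp : (0 : ℂ) ∈ {z : ℂ | -1 < z.re})]
    with w hw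
  have hw1 : -1 < w.re := hw
  have hw2 : -1 < (w + 2).re := by simp only [Complex.add_re, Complex.re_ofNat]; linarith
  rw [entireTransform_eq hg u hw1, entireTransform_eq hg u hw2, entireTransform_eq _ u hw2]
  exact regTransform_recursion hg u hw1

theorem isCosContinuation_entireTransform {n : ℕ} [NeZero n] {f : USphere n → ℂ}
    (hf : SphereSmooth f) :
    IsCosContinuation f fun lam u => Complex.Gamma (-lam / 2) * entireTransform hf u lam := by
  refine ⟨fun u z => ?_, fun u z hz => ?_, fun u lam hlam _ => ?_, fun u lam hlam _ => ?_⟩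
  · have h1 : Differentiable ℂ fun w : ℂ => (Complex.Gamma (-w / 2))⁻¹ :=
      Complex.differentiable_one_div_Gamma.comp
        (by fun_prop : Differentiable ℂ fun w : ℂ => -w / 2)
    have h2 := (h1.analyticAt z).meromorphicAt.inv
    have h3 : (fun w : ℂ => (Complex.Gamma (-w / 2))⁻¹)⁻¹ = fun w : ℂ => Complex.Gamma (-w / 2) :=
      funext fun w => inv_inv _
    rw [h3] at h2
    exact h2.mul ((differentiable_entireTransform hf u).analyticAt z).meromorphicAt
  · have hne : ∀ m : ℕ, -z / 2 ≠ -m := fun m h => hz m (by linear_combination -2 * h)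
    have h1 : DifferentiableAt ℂ (fun w : ℂ => Complex.Gamma (-w / 2)) z :=
      DifferentiableAt.comp (g := Complex.Gamma) (f := fun w : ℂ => -w / 2) z
        (Complex.differentiableAt_Gamma _ hne) (by fun_prop)
    exact (h1.mul (differentiable_entireTransform hf u z)).differentiableWithinAt
  · exact integrable_mul_kernel hf.continuous (integrable_abs_sdot_cpow u hlam)
  · change _ = cosFactor n lam * zonal (powKernel lam) f u
    simp only [entireTransform_eq hf u hlam, regTransform, cosFactor, div_eq_mul_inv, mul_inv]
    ring

theorem isCosContinuation_cosTransform {n : ℕ} [NeZero n] {f : USphere n → ℂ}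
    (hf : SphereSmooth f) : IsCosContinuation f fun lam => cosTransform lam f := by
  have h : ∃ G, IsCosContinuation f G := ⟨_, isCosContinuation_entireTransform hf⟩
  have h2 : (fun lam => cosTransform lam f) = h.choose := by
    funext lam
    simp [cosTransform, h]
  rw [h2]
  exact h.choose_spec

theorem neg_two_mul_mem_regularSet {l : ℕ} (hl : 1 ≤ l) : -2 * (l : ℂ) ∈ regularSet := by
  intro k hk
  have h1 : ((k + l : ℕ) : ℂ) = 0 := by push_cast; linear_combination (-1 / 2) * hk
  have h2 : k + l = 0 := by exact_mod_cast h1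
  omega

theorem cosTransform_neg_two_mul {n : ℕ} [NeZero n] {f : USphere n → ℂ} (hf : SphereSmooth f)
    {l : ℕ} (hl : 1 ≤ l) (u : USphere n) :
    cosTransform (-2 * (l : ℂ)) f u =
      Complex.Gamma l * entireTransform hf u (-2 * (l : ℂ)) := by
  have h := (isCosContinuation_cosTransform hf).unique (isCosContinuation_entireTransform hf)
    (neg_two_mul_mem_regularSet hl) u
  rw [h, show -(-2 * (l : ℂ)) / 2 = l by ring]

/-! ### The logarithmic transform -/

/-- The kernel of the logarithmic cosine transform. -/
noncomputable def logKernel (n : ℕ) (t : ℝ) : ℂ :=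
  2 / Complex.Gamma ((n : ℂ) / 2) * ((Real.log (1 / |t|) : ℝ) : ℂ)

theorem cosLog_eq_zonal {n : ℕ} (f : USphere n → ℂ) : cosLog f = zonal (logKernel n) f := by
  funext u
  rw [cosLog, zonal, ← integral_const_mul]
  refine integral_congr_ae (Filter.Eventually.of_forall fun v => ?_)
  simp only [logIntegrand, logKernel]
  ring

theorem integrable_log_inv_abs_sdot {n : ℕ} [NeZero n] (u : USphere n) :
    Integrable (fun v => ((Real.log (1 / |sdot u v|) : ℝ) : ℂ)) (sphereProb n) := by
  simp only [one_div, Real.log_inv]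
  exact (integrable_log_abs_sdot u).neg.ofReal

theorem integrable_logKernel {n : ℕ} [NeZero n] (u : USphere n) :
    Integrable (fun v => logKernel n (sdot u v)) (sphereProb n) :=
  (integrable_log_inv_abs_sdot u).const_mul _

theorem SphereSmooth.cosLog {n : ℕ} [NeZero n] {f : USphere n → ℂ} (hf : SphereSmooth f) :
    SphereSmooth (cosLog f) := by
  rw [cosLog_eq_zonal]
  exact hf.zonal integrable_logKernel

theorem sphLap_cosLog {n : ℕ} [NeZero n] {f : USphere n → ℂ} (hf : SphereSmooth f) :
    sphLap (cosLog f) = cosLog (sphLap f) := by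
  simp only [cosLog_eq_zonal]
  exact sphLap_zonal hf integrable_logKernel

/-- The logarithmic transform is the derivative at `λ = 0` of the power transforms of a function
of mean zero. -/
theorem hasDerivAt_regTransform_zero {n : ℕ} [NeZero n] {g : USphere n → ℂ}
    (hg : SphereSmooth g) (hmean : ∫ v, g v ∂(sphereProb n) = 0) (u : USphere n) :
    HasDerivAt (regTransform g u) (-(1 / 2) * cosLog g u) 0 := by
  have h1 := hasDerivAt_zonal_powKernel hg.continuous u (lam := 0) (by simp)
  have h2 : DifferentiableAt ℂ (fun z : ℂ => (Real.sqrt Real.pi : ℂ) *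
      (Complex.Gamma ((n : ℂ) / 2))⁻¹ * (Complex.Gamma ((z + 1) / 2))⁻¹) 0 :=
    ((Complex.differentiable_one_div_Gamma.comp
      (by fun_prop : Differentiable ℂ fun z : ℂ => (z + 1) / 2)) 0).const_mul _
  refine (h2.hasDerivAt.mul h1).congr_deriv ?_
  have hpi : (Real.sqrt Real.pi : ℂ) ≠ 0 := by
    have := Real.sqrt_pos.2 Real.pi_pos
    exact_mod_cast this.ne'
  have hG : Complex.Gamma ((0 + 1) / 2) = (Real.sqrt Real.pi : ℂ) := by
    rw [zero_add]
    have h := Real.Gamma_one_half_eq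
    rw [← h, ← Complex.Gamma_ofReal]
    push_cast
    rfl
  have hint : ∫ v, g v * ((Real.log |sdot u v| : ℂ) * powKernel 0 (sdot u v)) ∂(sphereProb n) =
      -∫ v, logIntegrand g u v ∂(sphereProb n) := by
    rw [← integral_neg]
    refine integral_congr_ae (Filter.Eventually.of_forall fun v => ?_)
    simp [logIntegrand, powKernel]
  rw [zonal_powKernel_zero, hmean, hG, hint, cosLog]
  field_simp
  ring

theorem cosTransform_neg_two {n : ℕ} [NeZero n] {f : USphere n → ℂ} (hf : SphereSmooth f)
    (hmean : ∫ v, f v ∂(sphereProb n) = 0) (u : USphere n) :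
    cosTransform (-2) f u = -(1 / 4) * cosLog (sphLap f) u := by
  have h1 := cosTransform_neg_two_mul hf le_rfl u
  simp only [Nat.cast_one, mul_one, Complex.Gamma_one, one_mul] at h1
  rw [h1]
  have hev : ∀ {g : USphere n → ℂ} (hg : SphereSmooth g),
      entireTransform hg u =ᶠ[nhds 0] regTransform g u := by
    intro g hg
    filter_upwards [(isOpen_re_gt (-1)).mem_nhds (by simp : (0 : ℂ) ∈ {z : ℂ | -1 < z.re})]
      with w hw
    exact entireTransform_eq hg u hw
  have hshift : HasDerivAt (fun z : ℂ => z + 2) 1 (-2) := (hasDerivAt_id _).add_const 2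
  have hD : HasDerivAt (fun z => entireTransform hf.sphLap u (z + 2))
      (-(1 / 2) * cosLog (sphLap f) u) (-2) := by
    have h := (hasDerivAt_regTransform_zero hf.sphLap (integral_sphLap hf) u).congr_of_eventuallyEq
      (hev hf.sphLap)
    rw [show (0 : ℂ) = -2 + 2 by norm_num] at h
    exact (HasDerivAt.comp (h := fun z : ℂ => z + 2) (-2) h hshift).congr_deriv (mul_one _)
  have hf0 : entireTransform hf u (-2 + 2) = 0 := by
    rw [show (-2 + 2 : ℂ) = 0 by norm_num, entireTransform_eq hf u (by simp),
      regTransform_zero hmean]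
  -- Differentiate the recursion at `λ = -2`, where both of its sides vanish.
  have hL : HasDerivAt (fun z => 2 * (z + 2) * entireTransform hf u z)
      (2 * entireTransform hf u (-2)) (-2) := by
    have h := (hshift.const_mul 2).mul (differentiable_entireTransform hf u (-2)).hasDerivAt
    refine h.congr_deriv ?_
    simp
  have hR : HasDerivAt (fun z => entireTransform hf.sphLap u (z + 2) +
      (z + 2) * (z + n) * entireTransform hf u (z + 2)) (-(1 / 2) * cosLog (sphLap f) u) (-2) := by
    have hd := differentiable_entireTransform hf u
    have hd2 : DifferentiableAt ℂ (fun z => (z + n) * entireTransform hf u (z + 2)) (-2) := by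
      fun_prop
    have h := hD.add (hshift.mul hd2.hasDerivAt)
    simp only [hf0, mul_zero] at h
    refine (h.congr_deriv (by simp)).congr_of_eventuallyEq (Filter.Eventually.of_forall fun z => ?_)
    simp only [Pi.add_apply, Pi.mul_apply]
    ring
  have hrec : (fun z => 2 * (z + 2) * entireTransform hf u z) = _ :=
    funext fun z => entireTransform_recursion hf u z
  rw [hrec] at hL
  have := hL.unique hR
  linear_combination (1 / 2) * this

theorem cosTransform_neg_two_mul_succ {n : ℕ} [NeZero n] {f : USphere n → ℂ}
    (hf : SphereSmooth f) {l : ℕ} (hl : 1 ≤ l) (u : USphere n) :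
    cosTransform (-2 * ((l + 1 : ℕ) : ℂ)) f u =
      -(1 / 4) * (cosTransform (-2 * (l : ℂ)) (sphLap f) u +
        -2 * l * (-2 * l + n - 2) * cosTransform (-2 * (l : ℂ)) f u) := by
  have hl0 : (l : ℂ) ≠ 0 := by
    have : l ≠ 0 := by omega
    exact_mod_cast this
  rw [cosTransform_neg_two_mul hf (by omega), cosTransform_neg_two_mul hf hl,
    cosTransform_neg_two_mul hf.sphLap hl]
  have hrec := entireTransform_recursion hf u (-2 * ((l + 1 : ℕ) : ℂ))
  have e : -2 * ((l + 1 : ℕ) : ℂ) + 2 = -2 * l := by push_cast; ring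
  rw [e] at hrec
  push_cast at hrec ⊢
  rw [Complex.Gamma_add_one _ hl0]
  linear_combination (-(1 / 4) * Complex.Gamma l) * hrec

/-! ### Iterated Laplacians -/

theorem rotDeriv_add_const_mul {n : ℕ} (A : Euc n →L[ℝ] Euc n) {f g : USphere n → ℂ}
    (hf : SphereSmooth f) (hg : SphereSmooth g) (c : ℂ) :
    rotDeriv A (f + fun v => c * g v) = rotDeriv A f + fun v => c * rotDeriv A g v := by
  funext u
  have h : homExt 0 (f + fun v => c * g v) = homExt 0 f + fun x => c * homExt 0 g x :=
    funext fun x => by simp [homExt_zero_add, homExt_zero_const_mul]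
  have hd1 := hf.differentiableAt (coe_ne_zero u)
  have hd2 := hg.differentiableAt (coe_ne_zero u)
  simp only [rotDeriv, h, Pi.add_apply]
  rw [fderiv_add hd1 (hd2.const_mul c), fderiv_const_mul hd2]
  simp

theorem sphLap_add_const_mul {n : ℕ} {f g : USphere n → ℂ}
    (hf : SphereSmooth f) (hg : SphereSmooth g) (c : ℂ) :
    sphLap (f + fun v => c * g v) = sphLap f + fun v => c * sphLap g v := by
  funext u
  simp only [sphLap, Pi.add_apply, rotDeriv_add_const_mul _ hf hg,
    rotDeriv_add_const_mul _ (hf.rotDeriv _) (hg.rotDeriv _), Finset.sum_add_distrib,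
    ← Finset.mul_sum]
  ring

/-- The polynomial in `sphLap` by which `Δ^l` acts on functions homogeneous of degree `0`. -/
noncomputable def sphLapPoly {n : ℕ} : ℕ → (USphere n → ℂ) → USphere n → ℂ
  | 0, g => g
  | l + 1, g => sphLap (sphLapPoly l g) +
      fun v => -2 * (l : ℂ) * (-2 * (l : ℂ) + n - 2) * sphLapPoly l g v

theorem SphereSmooth.sphLapPoly {n : ℕ} {g : USphere n → ℂ} (hg : SphereSmooth g) (l : ℕ) :
    SphereSmooth (sphLapPoly l g) := by
  induction l with
  | zero => exact hg
  | succ l ih => exact ih.sphLap.add (ih.const_mul _)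

theorem sphLapPoly_sphLap {n : ℕ} {g : USphere n → ℂ} (hg : SphereSmooth g) (l : ℕ) :
    sphLapPoly l (sphLap g) = sphLap (sphLapPoly l g) := by
  induction l with
  | zero => rfl
  | succ l ih =>
    rw [sphLapPoly, sphLapPoly, sphLap_add_const_mul (hg.sphLapPoly l).sphLap (hg.sphLapPoly l), ih]

theorem iterate_laplacian_homExt {n : ℕ} {g : USphere n → ℂ} (hg : SphereSmooth g) (l : ℕ) :
    ∀ x : Euc n, x ≠ 0 →
      ((Laplacian.laplacian : (Euc n → ℂ) → Euc n → ℂ)^[l] (homExt 0 g)) x =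
        homExt (-2 * (l : ℂ)) (sphLapPoly l g) x := by
  induction l with
  | zero => intro x _; simp [sphLapPoly]
  | succ l ih =>
    intro x hx
    rw [Function.iterate_succ_apply']
    have hev : ((Laplacian.laplacian : (Euc n → ℂ) → Euc n → ℂ)^[l] (homExt 0 g)) =ᶠ[nhds x]
        homExt (-2 * (l : ℂ)) (sphLapPoly l g) := by
      filter_upwards [isOpen_compl_zero.mem_nhds hx] with y hy
      exact ih y hy
    rw [(InnerProductSpace.laplacian_congr_nhds hev).self_of_nhds,
      laplacian_homExt (hg.sphLapPoly l) _ hx]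
    congr 1
    push_cast
    ring

theorem wLapPow_eq {n : ℕ} {g : USphere n → ℂ} (hg : SphereSmooth g) (l : ℕ) (u : USphere n) :
    wLapPow (-2 * (l : ℂ)) l g u = (-(1 / 4 : ℂ)) ^ l * sphLapPoly l g u := by
  rw [wLapPow, show -2 * (l : ℂ) + 2 * l = 0 by ring,
    iterate_laplacian_homExt hg l _ (coe_ne_zero u), homExt_coe]

theorem cosTransform_eq_sphLapPoly {n : ℕ} [NeZero n] {l : ℕ} (hl : 1 ≤ l) :
    ∀ f : USphere n → ℂ, SphereSmooth f → ∫ v, f v ∂(sphereProb n) = 0 → ∀ u : USphere n,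
      cosTransform (-2 * (l : ℂ)) f u = (-(1 / 4 : ℂ)) ^ l * sphLapPoly l (cosLog f) u := by
  induction l, hl using Nat.le_induction with
  | base =>
    intro f hf hmean u
    have h := cosTransform_neg_two hf hmean u
    rw [← sphLap_cosLog hf] at h
    simpa [sphLapPoly] using h
  | succ l hl ih =>
    intro f hf hmean u
    rw [cosTransform_neg_two_mul_succ hf hl, ih f hf hmean u,
      ih _ hf.sphLap (integral_sphLap hf) u, ← sphLap_cosLog hf, sphLapPoly_sphLap hf.cosLog]
    simp only [sphLapPoly, Pi.add_apply]
    ring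

end CosineTransform

theorem lemma2p3 (n : ℕ) (hn : 3 ≤ n) (f : CosineTransform.USphere n → ℂ)
    (hsmooth : CosineTransform.SphereSmooth f)
    (heven : ∀ v : CosineTransform.USphere n, f (-v) = f v)
    (hmean : ∫ v, f v ∂(CosineTransform.sphereProb n) = 0) :
    -- the functions in the identities are well defined
    CosineTransform.IsCosContinuation f (fun lam => CosineTransform.cosTransform lam f) ∧
    (∀ u : CosineTransform.USphere n,
      MeasureTheory.Integrable (CosineTransform.logIntegrand f u) (CosineTransform.sphereProb n)) ∧
    CosineTransform.SphereSmooth (CosineTransform.cosLog f) ∧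
    -- the identities
    CosineTransform.wLap (-2) (CosineTransform.cosLog f) = CosineTransform.cosTransform (-2) f ∧
    ∀ l : ℕ, 1 ≤ l →
      CosineTransform.wLapPow (-2 * (l : ℂ)) l (CosineTransform.cosLog f) =
        CosineTransform.cosTransform (-2 * (l : ℂ)) f := by
  have : NeZero n := ⟨by omega⟩
  have key : ∀ l : ℕ, 1 ≤ l →
      CosineTransform.wLapPow (-2 * (l : ℂ)) l (CosineTransform.cosLog f) =
        CosineTransform.cosTransform (-2 * (l : ℂ)) f := fun l hl => funext fun u => by
    rw [CosineTransform.wLapPow_eq hsmooth.cosLog,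
      CosineTransform.cosTransform_eq_sphLapPoly hl f hsmooth hmean u]
  refine ⟨CosineTransform.isCosContinuation_cosTransform hsmooth, fun u =>
    CosineTransform.integrable_mul_kernel hsmooth.continuous
      (CosineTransform.integrable_log_inv_abs_sdot u), hsmooth.cosLog, ?_, key⟩
  have h := key 1 le_rfl
  simp only [Nat.cast_one, mul_one] at h
  rw [← h]
  funext u
  simp [CosineTransform.wLap, CosineTransform.wLapPow]
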